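/- Four parties $A,B,C,D$ share a single copy of a four-qubit W-class state, which up to local unitaries has the form $$\sqrt{x_0}|0000\rangle+\sqrt{x_A}|1000\rangle+\sqrt{x_B}|0100\rangle+\sqrt{x_C}|0010\rangle+\sqrt{x_D}|0001\rangle,$$ with $x_A,x_B,x_C,x_D\ge 0$ and $x_0=1-(x_A+x_B+x_C+x_D)\ge 0$; write $\vec x=(x_A,x_B,x_C,x_D)$ for its component vector (some components may vanish; if exactly two components are nonzero, the component vector of the state is made unique by requiring $x_0=0$ and that the first of the two is the larger one). Let $\mathcal G$ be a graph on the four parties which is, up to a permutation of the parties, one of the three graphs with edge sets $\{AB,CD\}$, $\{AB,BC,CD\}$, $\{AB,BC,CD,AD\}$ (Configurations III). For a vector $\vec x$ let $n_1$ be a party with the largest component, $n_1'$ a party with the largest component among the parties not joined to $n_1$ in $\mathcal G$, and $p,p'$ the other two parties, and put $$\tau(\vec x)=2x_p+2x_{p'}-2\frac{x_px_{p'}}{x_{n_1}}+\frac23\,\frac{x_px_{p'}x_{n_1'}}{x_{n_1}^2}\qquad(\tau(\vec 0)=0).$$ Theorem. Such parties always exist and $\tau(\vec x)$ does not depend on how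 they are chosen. Every outcome of nonzero probability of an LOCC protocol (finitely many rounds, arbitrary local measurements, local ancillas allowed) applied to a state of the above form is again of the above form up to local unitaries, and $\tau$ is an entanglement monotone: if an LOCC protocol takes a state with component vector $\vec x$ to states with component vectors $\vec y_\lambda$ with probabilities $p_\lambda$, then $$\sum_\lambda p_\lambda\,\tau(\vec y_\lambda)\le\tau(\vec x).$$ Consequently, if $P(\vec x,\mathcal G)$ denotes the supremum, over all LOCC protocols acting on one copy of the above state, of the total probability that the final state is an EPR pair $\frac1{\sqrt2}(|00\rangle+|11\rangle)$, up to local unitaries, shared by two parties joined by an edge of $\mathcal G$, with the other two parties in a product state, then $$P(\vec x,\mathcal G)\le\tau(\vec x).$$ -/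

import Mathlib

namespace WClass

noncomputable section

/-! ### Four-party pure states and local maps

The parties `A, B, C, D` are `0, 1, 2, 3 : Fin 4`. -/

/-- Vectors of four parties, each holding a `d`-level system, in the computational basis. -/
abbrev State (d : ℕ) : Type := (Fin 4 → Fin d) → ℂ

/-- The squared norm of a (possibly unnormalised) vector. -/
def normSq {d : ℕ} (ψ : State d) : ℝ := ∑ s, ‖ψ s‖ ^ 2

/-- The operator `M` applied by party `k`, the identity acting on all the others. -/
def applyLocal {d : ℕ} (k : Fin 4) (M : Matrix (Fin d) (Fin d) ℂ) (ψ : State d) : State d :=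
  fun s => ∑ t : Fin d, M (s k) t * ψ (Function.update s k t)

/-- `V 0 ⊗ V 1 ⊗ V 2 ⊗ V 3` applied to a vector of four qubits. -/
def tensorMap {d : ℕ} (V : Fin 4 → Matrix (Fin d) (Fin 2) ℂ) (φ : State 2) : State d :=
  fun s => ∑ t : Fin 4 → Fin 2, (∏ k, V k (s k) (t k)) * φ t

/-- `ψ` arises from the four-qubit vector `φ` by local isometries, i.e. by local unitaries
together with local ancillas in pure states. For `d = 2` this is local unitary equivalence. -/
def LocallyEquivalent {d : ℕ} (ψ : State d) (φ : State 2) : Prop :=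
  ∃ V : Fin 4 → Matrix (Fin d) (Fin 2) ℂ,
    (∀ k, (V k).conjTranspose * V k = 1) ∧ ψ = tensorMap V φ

/-! ### W-class states and their component vectors -/

/-- `√x₀|0000⟩ + √x_A|1000⟩ + √x_B|0100⟩ + √x_C|0010⟩ + √x_D|0001⟩`,
where `x₀ = 1 - (x_A + x_B + x_C + x_D)`. -/
def wState (x : Fin 4 → ℝ) : State 2 := fun s =>
  if s = 0 then (Real.sqrt (1 - ∑ k, x k) : ℂ)
  else ∑ k, if s = Pi.single k 1 then (Real.sqrt (x k) : ℂ) else 0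

/-- The vectors `x` with nonnegative components and `x₀ ≥ 0`. -/
def IsVector (x : Fin 4 → ℝ) : Prop := (∀ k, 0 ≤ x k) ∧ ∑ k, x k ≤ 1

/-- `x` is the component vector of the state `ψ`. If only two parties have a nonzero component,
then the vector is made unique by the convention that `x₀ = 0` and that the component of the
first of the two parties is the larger one. -/
def IsVectorOf {d : ℕ} (ψ : State d) (x : Fin 4 → ℝ) : Prop :=
  IsVector x ∧
  (∀ i j, i < j → x i ≠ 0 → x j ≠ 0 → (∀ k, k ≠ i → k ≠ j → x k = 0) →
    ∑ k, x k = 1 ∧ x j ≤ x i) ∧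
  LocallyEquivalent ψ (wState x)

/-! ### LOCC protocols -/

/-- LOCC protocols (finitely many rounds) on four `d`-level systems, as trees: either stop, or
some party `k` performs a measurement with Kraus operators `M i`, `∑ i, (M i)ᴴ * M i = 1`,
announces the outcome `i`, and the parties go on with a protocol that depends on `i`.
Ancillas are allowed for since `d` is arbitrary. -/
inductive LOCC (d : ℕ) : Type
  | halt : LOCC d
  | measure (k : Fin 4) (n : ℕ) (M : Fin n → Matrix (Fin d) (Fin d) ℂ)
      (complete : ∑ i, (M i).conjTranspose * M i = 1) (next : Fin n → LOCC d) : LOCC d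

namespace LOCC

/-- The possible records of all measurement outcomes in a run of the protocol. -/
def Outcome {d : ℕ} : LOCC d → Type
  | halt => Unit
  | measure _ n _ _ next => Σ i : Fin n, (next i).Outcome

instance instFintypeOutcome {d : ℕ} : (L : LOCC d) → Fintype L.Outcome
  | halt => inferInstanceAs (Fintype Unit)
  | measure _ n _ _ next =>
    letI : ∀ i : Fin n, Fintype (next i).Outcome := fun i => instFintypeOutcome (next i)
    inferInstanceAs (Fintype (Σ i : Fin n, (next i).Outcome))

/-- The unnormalised final vector: the product of the Kraus operators along the record `o`
applied to `ψ`. -/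
def final {d : ℕ} : (L : LOCC d) → State d → L.Outcome → State d
  | halt, ψ, _ => ψ
  | measure k _ M _ next, ψ, o => final (next o.1) (applyLocal k (M o.1) ψ) o.2

/-- The probability of the record `o` when the protocol is run on the unit vector `ψ`. -/
def prob {d : ℕ} (L : LOCC d) (ψ : State d) (o : L.Outcome) : ℝ := normSq (L.final ψ o)

/-- The final state after the record `o` (meaningful if its probability is nonzero). -/
def post {d : ℕ} (L : LOCC d) (ψ : State d) (o : L.Outcome) : State d :=
  ((Real.sqrt (L.prob ψ o) : ℂ)⁻¹) • L.final ψ o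

end LOCC

/-- A function of the component vector is an entanglement monotone on four-qubit W-class states
if it does not increase on average under LOCC. -/
def IsEntanglementMonotone (f : (Fin 4 → ℝ) → ℝ) : Prop :=
  ∀ (d : ℕ) (ψ : State d) (x : Fin 4 → ℝ), IsVectorOf ψ x →
    ∀ (L : LOCC d) (y : L.Outcome → Fin 4 → ℝ),
      (∀ o, L.prob ψ o ≠ 0 → IsVectorOf (L.post ψ o) (y o)) →
        ∑ o, L.prob ψ o * f (y o) ≤ f x

/-! ### Random distillation -/

/-- `(|00⟩ + |11⟩) / √2` shared by the parties `i` and `j`, the others being in `|0⟩`. -/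
def epr (i j : Fin 4) : State 2 := fun s =>
  if s i = s j ∧ ∀ k, k ≠ i → k ≠ j → s k = 0 then ((Real.sqrt 2 : ℂ)⁻¹) else 0

/-- Two parties joined by an edge of `G` share an EPR pair (up to local unitaries), and the
others are in a product state. -/
def IsSuccess {d : ℕ} (G : SimpleGraph (Fin 4)) (ψ : State d) : Prop :=
  ∃ i j, G.Adj i j ∧ LocallyEquivalent ψ (epr i j)

open Classical in
/-- The total probability with which the protocol ends in an EPR pair along an edge of `G`. -/
def successProb {d : ℕ} (G : SimpleGraph (Fin 4)) (L : LOCC d) (ψ : State d) : ℝ :=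
  ∑ o, if IsSuccess G (L.post ψ o) then L.prob ψ o else 0

/-- The success probabilities of all LOCC protocols on the four-qubit state `φ`, with any local
ancillas. -/
def achievable (φ : State 2) (G : SimpleGraph (Fin 4)) : Set ℝ :=
  {q | ∃ (d : ℕ) (ψ : State d) (L : LOCC d), LocallyEquivalent ψ φ ∧ q = successProb G L ψ}

/-- `P(φ, G)`, the supremum of the success probabilities of all LOCC protocols. -/
def optProb (φ : State 2) (G : SimpleGraph (Fin 4)) : ℝ := sSup (achievable φ G)

/-! ### Configurations III and the function `τ` -/

/-- The edges `AB`, `CD`. -/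
def configIII₁ : SimpleGraph (Fin 4) := SimpleGraph.fromEdgeSet {s(0, 1), s(2, 3)}

/-- The edges `AB`, `BC`, `CD`. -/
def configIII₂ : SimpleGraph (Fin 4) := SimpleGraph.fromEdgeSet {s(0, 1), s(1, 2), s(2, 3)}

/-- The edges `AB`, `BC`, `CD`, `AD`. -/
def configIII₃ : SimpleGraph (Fin 4) :=
  SimpleGraph.fromEdgeSet {s(0, 1), s(1, 2), s(2, 3), s(0, 3)}

/-- One of the three Configurations III, up to a permutation of the parties. -/
def IsConfigIII (G : SimpleGraph (Fin 4)) : Prop :=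
  Nonempty (G ≃g configIII₁) ∨ Nonempty (G ≃g configIII₂) ∨ Nonempty (G ≃g configIII₃)

/-- `(n₁, n₁', p, p') = (σ 0, σ 1, σ 2, σ 3)`: the component of `n₁` is maximal, `n₁'` has the
largest component among the parties not connected to `n₁`, and `p`, `p'` are the other two. -/
def IsLabelling (G : SimpleGraph (Fin 4)) (x : Fin 4 → ℝ) (σ : Equiv.Perm (Fin 4)) : Prop :=
  (∀ k, x k ≤ x (σ 0)) ∧ ¬ G.Adj (σ 0) (σ 1) ∧
    ∀ k, k ≠ σ 0 → ¬ G.Adj (σ 0) k → x k ≤ x (σ 1)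

/-- The formula for `τ` in terms of `n₁`, `n₁'`, `p`, `p'`. At `x = 0` its value is `0`. -/
def tauFormula (x : Fin 4 → ℝ) (σ : Equiv.Perm (Fin 4)) : ℝ :=
  2 * x (σ 2) + 2 * x (σ 3) - 2 * (x (σ 2) * x (σ 3) / x (σ 0))
    + 2 / 3 * (x (σ 2) * x (σ 3) * x (σ 1) / x (σ 0) ^ 2)

open Classical in
/-- The function `τ` for the configuration `G`, with some choice of `n₁`, `n₁'`, `p`, `p'`. -/
def tau (G : SimpleGraph (Fin 4)) (x : Fin 4 → ℝ) : ℝ :=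
  if h : ∃ σ, IsLabelling G x σ then tauFormula x h.choose else 0

end

end WClass

namespace WClass

open Matrix

/-! The function `τ` is homogeneous of degree one and, in each component separately, concave and
nondecreasing; monotonicity under LOCC follows from this. If party `k` holds the isometry `V k` and
applies the Kraus operator `M i`, a QR decomposition `M i * V k = U * R` with `R` upper triangular
(`exists_qr`) keeps the state in the span of `|0000⟩` and the single excitations. The weights become
`s i * x j` for `j ≠ k` and `t i * x k`, where `∑ s i = 1` and `∑ t i ≤ 1` (`HasWeights.measure`).
Taking out the factor `s i` by homogeneity and using a supporting line of slope `g ≥ 0` at `x k`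
bounds the sum of the new values by `τ(x) + g * x k * (∑ t i - 1) ≤ τ(x)` (`IsSparse.sum_tau_le`).
Since weights are left unnormalised, probabilities are absorbed by homogeneity and an induction over
the protocol suffices (`HasWeights.exists_final`).

The supporting lines (`IsSparse.exists_slope`) have the slope of the formula at the current
labelling; the difficulty is that the labelling changes as a component moves. Upper bounds remain
accessible because a correct labelling gives the smallest value of the formula among all choices of
a maximal party and a party not joined to it (`core_le_core_of_max`). Of the graph only two facts
are needed: no vertex is joined to all others, and there are no triangles.

The weights followed along a protocol need not obey the convention for two nonzero components. The
products `x i * x j` are invariant under local isometries (`mul_le_mul_of_locallyEquivalent`). They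
determine a vector with at least three nonzero components, and for exactly two the convention `x₀ =
0` gives the smallest `τ` (`IsSparse.tau_le_of_mul_eq`). An EPR pair along an edge has `τ = 1`, so
the average of `τ` dominates the success probability. -/

/-- The expression defining `τ`, as a function of the four components. -/
noncomputable def core (n n' p p' : ℝ) : ℝ :=
  2 * p + 2 * p' - 2 * (p * p' / n) + 2 / 3 * (p * p' * n' / n ^ 2)

/-! ### Symmetry, homogeneity and exchange inequalities of the formula -/

lemma core_comm (n n' p p' : ℝ) : core n n' p p' = core n n' p' p := by
  unfold core; ring

lemma core_smul {s : ℝ} (hs : s ≠ 0) (n n' p p' : ℝ) :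
    core (s * n) (s * n') (s * p) (s * p') = s * core n n' p p' := by
  unfold core
  rcases eq_or_ne n 0 with rfl | hn
  · simp; ring
  · field_simp

/-- The cubic term is symmetric in `n'`, `p`, `p'`, so an exchange of `n'` and `p` affects only the
lower terms and changes the value by `2 * (n' - p) * (1 - p' / n)`. -/
lemma core_exchange_le {n n' p p' : ℝ} (hp' : 0 ≤ p') (hpn : p' ≤ n) (h : p ≤ n') :
    core n n' p p' ≤ core n p n' p' := by
  have h1 : p' / n ≤ 1 := div_le_one_of_le₀ hpn (hp'.trans hpn)
  have h2 : core n p n' p' - core n n' p p' = 2 * ((n' - p) * (1 - p' / n)) := by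
    unfold core; ring
  nlinarith [mul_nonneg (sub_nonneg.2 h) (sub_nonneg.2 h1)]

lemma core_exchange_self {n n' p : ℝ} (hn' : 0 ≤ n') (hp : 0 ≤ p) (hn'n : n' ≤ n) (hpn : p ≤ n) :
    core n n' p n = core n p n' n := by
  rcases eq_or_ne n 0 with rfl | hn
  · rw [le_antisymm hn'n hn', le_antisymm hpn hp]
  · unfold core; field_simp; ring

lemma core_nonneg {n n' p p' : ℝ} (hn' : 0 ≤ n') (hp : 0 ≤ p) (hp' : 0 ≤ p') (hpn : p ≤ n) :
    0 ≤ core n n' p p' := by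
  have h1 : p / n ≤ 1 := div_le_one_of_le₀ hpn (hp.trans hpn)
  have h2 : core n n' p p' = 2 * p + 2 * (p' * (1 - p / n)) + 2 / 3 * (p * p' * n' / n ^ 2) := by
    unfold core; ring
  rw [h2]
  have := mul_nonneg hp' (sub_nonneg.2 h1)
  positivity

/-! ### Supporting lines of the formula, at maximal component `1` -/

lemma core_one (a b c : ℝ) : core 1 a b c = 2 * b + 2 * c - 2 * (b * c) + 2 / 3 * (b * c * a) := by
  simp [core]

/-- The slope is the derivative of `core 1 a b c` in `a`. Once `t` exceeds `1` the two opposite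
parties exchange roles, and the gap is a multiple of `(t - 1) ^ 3`. -/
lemma core_line_opposite {a b c : ℝ} (hb : 0 ≤ b) (hc : 0 ≤ c) {t : ℝ} (ht : 1 ≤ t) :
    core t 1 b c ≤ core 1 a b c + 2 / 3 * (b * c) * (t - a) := by
  have ht0 : 0 < t := by linarith
  have h : core 1 a b c + 2 / 3 * (b * c) * (t - a) - core t 1 b c
      = 2 / 3 * (b * c) * (t - 1) ^ 3 / t ^ 2 := by
    unfold core; field_simp; ring
  have : 0 ≤ 2 / 3 * (b * c) * (t - 1) ^ 3 / t ^ 2 := by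
    have : 0 ≤ t - 1 := by linarith
    positivity
  linarith

/-- The slope is the derivative of `core 1 a b c` in `b`. For `t ≥ 1` this party is the largest, and
the left side is the formula for the same pairing into opposite parties. -/
lemma core_line_other {a b c : ℝ} (ha : 0 ≤ a) (hc : 0 ≤ c) (ha1 : a ≤ 1)
    (hc1 : c ≤ 1) {t : ℝ} (ht : 1 ≤ t) :
    core t c 1 a ≤ core 1 a b c + (2 - 2 * c + 2 / 3 * (a * c)) * (t - b) := by
  have ht0 : 0 < t := by linarith
  have h : core 1 a b c + (2 - 2 * c + 2 / 3 * (a * c)) * (t - b) - core t c 1 a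
      = 2 * (t - 1) * ((1 - c) * ((1 - a) * t ^ 2 + a * (t * (t - 1)))
          + a * c * (t - 1) ^ 2 / 3) / t ^ 2 := by
    unfold core; field_simp; ring
  have : 0 ≤ 2 * (t - 1) * ((1 - c) * ((1 - a) * t ^ 2 + a * (t * (t - 1)))
          + a * c * (t - 1) ^ 2 / 3) / t ^ 2 := by
    have h1 : 0 ≤ t - 1 := by linarith
    have h2 : 0 ≤ 1 - c := by linarith
    have h3 : 0 ≤ 1 - a := by linarith
    positivity
  linarith

/-- The slope is the derivative of `core t a b c` in `t` at `1`. This lemma treats the range where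
the labelling persists; the next two treat values of `t` so small that another party takes over. -/
lemma core_line_max {a b c : ℝ} (hb : 0 ≤ b) (hc : 0 ≤ c) (ha1 : a ≤ 1)
    {t : ℝ} (ht : 0 < t) (hat : a ≤ t) :
    core t a b c ≤ core 1 a b c + (2 * (b * c) - 4 / 3 * (a * b * c)) * (t - 1) := by
  have h : core 1 a b c + (2 * (b * c) - 4 / 3 * (a * b * c)) * (t - 1) - core t a b c
      = 2 / 3 * (b * c) * (t - 1) ^ 2 * (2 * t * (1 - a) + (t - a)) / t ^ 2 := by
    unfold core; field_simp; ring
  have : 0 ≤ 2 / 3 * (b * c) * (t - 1) ^ 2 * (2 * t * (1 - a) + (t - a)) / t ^ 2 := by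
    have h1 : 0 ≤ 1 - a := by linarith
    have h2 : 0 ≤ t - a := by linarith
    positivity
  linarith

lemma core_line_max_opposite {a b c : ℝ} (ha : 0 < a) (hb : 0 ≤ b) (hc : 0 ≤ c) (ha1 : a ≤ 1)
    {t : ℝ} (hta : t ≤ a) :
    core a t b c ≤ core 1 a b c + (2 * (b * c) - 4 / 3 * (a * b * c)) * (t - 1) := by
  have h : core 1 a b c + (2 * (b * c) - 4 / 3 * (a * b * c)) * (t - 1) - core a t b c
      = 2 / 3 * (b * c) * (1 - a) ^ 2 * (2 * a * (1 - t) + (a - t)) / a ^ 2 := by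
    unfold core; field_simp; ring
  have : 0 ≤ 2 / 3 * (b * c) * (1 - a) ^ 2 * (2 * a * (1 - t) + (a - t)) / a ^ 2 := by
    have h1 : 0 ≤ 1 - t := by linarith
    have h2 : 0 ≤ a - t := by linarith
    positivity
  linarith

lemma core_line_max_other {a b c : ℝ} (ha : 0 ≤ a) (hb : 0 < b) (hc : 0 ≤ c) (hb1 : b ≤ 1)
    (hab : a ≤ b) (hcb : c ≤ b) {t : ℝ} (ht : 0 ≤ t) (htb : t ≤ b) :
    core b c t a ≤ core 1 a b c + (2 * (b * c) - 4 / 3 * (a * b * c)) * (t - 1) := by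
  -- The gap is affine in `t`; it is written as the convex combination of its values at `t = 0` and
  -- `t = b`.
  have h : core 1 a b c + (2 * (b * c) - 4 / 3 * (a * b * c)) * (t - 1) - core b c t a
      = (1 - t / b) * (2 * ((b - a) * (1 - c * b) + c * (1 - b) ^ 2))
        + t / b * (2 / 3 * c * (1 - b) ^ 2 * (2 * (b - a) + 2 * a * (1 - b) + (b - a)) / b) := by
    unfold core; field_simp; ring
  have h1 : 0 ≤ 1 - t / b := sub_nonneg.2 (div_le_one_of_le₀ htb hb.le)
  have h2 : 0 ≤ b - a := by linarith
  have h3 : 0 ≤ 1 - c * b := by nlinarith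
  have h4 : 0 ≤ 1 - b := by linarith
  have : 0 ≤ (1 - t / b) * (2 * ((b - a) * (1 - c * b) + c * (1 - b) ^ 2))
        + t / b * (2 / 3 * c * (1 - b) ^ 2 * (2 * (b - a) + 2 * a * (1 - b) + (b - a)) / b) := by
    positivity
  linarith

/-! ### Labellings of the parties -/

lemma nodup_cover {a b c d : Fin 4} (h : [a, b, c, d].Nodup) (k : Fin 4) :
    k = a ∨ k = b ∨ k = c ∨ k = d := by
  simp at h; omega

lemma core_congr (x : Fin 4 → ℝ) {a b c d q q' : Fin 4} (h : [a, b, c, d].Nodup)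
    (h' : [a, b, q, q'].Nodup) :
    core (x a) (x b) (x q) (x q') = core (x a) (x b) (x c) (x d) := by
  have : (q = c ∧ q' = d) ∨ (q = d ∧ q' = c) := by simp at h h'; omega
  rcases this with ⟨rfl, rfl⟩ | ⟨rfl, rfl⟩
  · rfl
  · exact core_comm ..

/-- The value of the formula at a maximal party `n` is the smallest one among all choices of a
maximal party and of a party not connected to it. -/
lemma core_le_core_of_max {G : SimpleGraph (Fin 4)} {x : Fin 4 → ℝ} (hx : ∀ k, 0 ≤ x k)
    {n n' p p' m m' q q' : Fin 4} (hn : [n, n', p, p'].Nodup) (hm : [m, m', q, q'].Nodup)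
    (hmax : ∀ k, x k ≤ x n) (hopt : ∀ k, k ≠ n → ¬ G.Adj n k → x k ≤ x n')
    (hmax' : ∀ k, x k ≤ x m) (hadj : ¬ G.Adj m m') :
    core (x n) (x n') (x p) (x p') ≤ core (x m) (x m') (x q) (x q') := by
  -- Same maximal party, different opposite party: the exchange inequality applies because `n'` is
  -- the largest non-neighbour.
  have key : ∀ p p', [n, n', p, p'].Nodup → m' = p → m = n →
      core (x n) (x n') (x p) (x p') ≤ core (x m) (x m') (x q) (x q') := by
    rintro p p' hn rfl rfl
    rw [core_congr x (a := m) (b := m') (c := n') (d := p') (by simp at hn ⊢; tauto) hm]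
    exact core_exchange_le (hx p') (hmax p') (hopt m' (by simp at hn; tauto) hadj)
  -- Here the maximum is attained at both `n` and `p`, so their components may be interchanged in
  -- the formula.
  have key2 : ∀ p p', [n, n', p, p'].Nodup → m = p →
      core (x n) (x n') (x p) (x p') ≤ core (x m) (x m') (x q) (x q') := by
    rintro p p' hn rfl
    have e : x m = x n := le_antisymm (hmax m) (hmax' n)
    rcases nodup_cover hn m' with rfl | rfl | rfl | rfl
    · have e' : x n' = x m' := le_antisymm (hmax n')
        (e ▸ hopt m (by simp at hn; tauto) (fun h => hadj h.symm))
      rw [core_congr x (a := m) (b := m') (c := n') (d := p') (by simp at hn ⊢; tauto) hm, e, e']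
    · rw [core_congr x (a := m) (b := m') (c := n) (d := p') (by simp at hn ⊢; tauto) hm, e]
    · simp at hm
    · rw [core_congr x (a := m) (b := m') (c := n') (d := n) (by simp at hn ⊢; tauto) hm, e]
      rw [core_comm]
      exact (core_exchange_self (hx _) (hx _) (hmax _) (hmax _)).le
  rcases nodup_cover hn m with rfl | rfl | rfl | rfl
  · rcases nodup_cover hn m' with rfl | rfl | rfl | rfl
    · simp at hm
    · exact (core_congr x hn hm).ge
    · exact key _ _ hn rfl rfl
    · rw [core_comm]
      exact key _ _ (by simp at hn ⊢; tauto) rfl rfl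
  · have e : x m = x n := le_antisymm (hmax m) (hmax' n)
    have key3 : ∀ p p', [n, m, p, p'].Nodup → m' = p →
        core (x n) (x m) (x p) (x p') ≤ core (x m) (x m') (x q) (x q') := by
      rintro p p' hn rfl
      rw [core_congr x (a := m) (b := m') (c := n) (d := p') (by simp at hn ⊢; tauto) hm, e]
      exact core_exchange_le (hx p') (hmax p') (hmax m')
    rcases nodup_cover hn m' with rfl | rfl | rfl | rfl
    · rw [core_congr x (a := m) (b := m') (c := p) (d := p') (by simp at hn ⊢; tauto) hm, e]
    · simp at hm
    · exact key3 _ _ hn rfl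
    · rw [core_comm]
      exact key3 _ _ (by simp at hn ⊢; tauto) rfl
  · exact key2 _ _ hn rfl
  · rw [core_comm]
    exact key2 _ _ (by simp at hn ⊢; tauto) rfl

lemma exists_perm_of_nodup {n n' p p' : Fin 4} (h : [n, n', p, p'].Nodup) :
    ∃ σ : Equiv.Perm (Fin 4), σ 0 = n ∧ σ 1 = n' ∧ σ 2 = p ∧ σ 3 = p' := by
  have hinj : Function.Injective ![n, n', p, p'] := by
    have h2 := List.nodup_iff_injective_get.1 h
    intro i j hij
    apply h2
    fin_cases i <;> fin_cases j <;> simp_all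
  exact ⟨Equiv.ofBijective _ (Finite.injective_iff_bijective.1 hinj), rfl, rfl, rfl, rfl⟩

lemma exists_nodup : ∀ {n n' : Fin 4}, n ≠ n' → ∃ p p', [n, n', p, p'].Nodup := by
  decide

lemma nodup_of_perm (σ : Equiv.Perm (Fin 4)) : [σ 0, σ 1, σ 2, σ 3].Nodup := by
  simp

/-! ### Triangle-free graphs without a dominating vertex -/

/-- The properties shared by Configurations III on which the results about `τ` rest. -/
structure IsSparse (G : SimpleGraph (Fin 4)) : Prop where
  exists_not_adj : ∀ v, ∃ w, w ≠ v ∧ ¬ G.Adj v w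
  not_triangle : ∀ u v w, G.Adj u v → G.Adj v w → ¬ G.Adj u w

lemma IsSparse.of_iso {G H : SimpleGraph (Fin 4)} (e : G ≃g H) (h : IsSparse H) :
    IsSparse G where
  exists_not_adj v := by
    obtain ⟨w, hw, hvw⟩ := h.exists_not_adj (e v)
    refine ⟨e.symm w, fun h => hw (by simp [← h]), fun h => hvw ?_⟩
    simpa using e.map_adj_iff.2 h
  not_triangle u v w h1 h2 h3 :=
    h.not_triangle _ _ _ (e.map_adj_iff.2 h1) (e.map_adj_iff.2 h2) (e.map_adj_iff.2 h3)

lemma IsConfigIII.isSparse {G : SimpleGraph (Fin 4)} (hG : IsConfigIII G) : IsSparse G := by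
  rcases hG with ⟨⟨e⟩⟩ | ⟨⟨e⟩⟩ | ⟨⟨e⟩⟩ <;> refine .of_iso e ⟨?_, ?_⟩ <;>
    simp only [configIII₁, configIII₂, configIII₃, SimpleGraph.fromEdgeSet_adj,
      Set.mem_insert_iff, Set.mem_singleton_iff, Sym2.eq_iff]
  any_goals decide
  all_goals intro u v w; omega

/-! ### Labellings exist, and basic values of `τ` -/

section Tau

variable {G : SimpleGraph (Fin 4)} {x : Fin 4 → ℝ}

lemma IsSparse.exists_isLabelling (hG : IsSparse G) (x : Fin 4 → ℝ) :
    ∃ σ, IsLabelling G x σ := by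
  classical
  obtain ⟨n, -, hn⟩ := Finset.exists_max_image Finset.univ x Finset.univ_nonempty
  obtain ⟨w, hw⟩ := hG.exists_not_adj n
  obtain ⟨n', hn', hmax⟩ := Finset.exists_max_image
    (Finset.univ.filter fun w => w ≠ n ∧ ¬ G.Adj n w) x ⟨w, by simpa using hw⟩
  simp only [Finset.mem_filter, Finset.mem_univ, true_and] at hn' hmax
  obtain ⟨p, p', h⟩ := exists_nodup hn'.1.symm
  obtain ⟨σ, rfl, rfl, -, -⟩ := exists_perm_of_nodup h
  exact ⟨σ, fun k => hn k (Finset.mem_univ k), hn'.2, fun k hk hk' => hmax k ⟨hk, hk'⟩⟩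

lemma tauFormula_le (hx : ∀ k, 0 ≤ x k) {σ τ : Equiv.Perm (Fin 4)} (hσ : IsLabelling G x σ)
    (hτ : ∀ k, x k ≤ x (τ 0)) (hτ' : ¬ G.Adj (τ 0) (τ 1)) :
    tauFormula x σ ≤ tauFormula x τ :=
  core_le_core_of_max hx (nodup_of_perm σ) (nodup_of_perm τ) hσ.1 hσ.2.2 hτ hτ'

lemma tau_eq (hx : ∀ k, 0 ≤ x k) {σ : Equiv.Perm (Fin 4)} (hσ : IsLabelling G x σ) :
    tau G x = tauFormula x σ := by
  have h : ∃ σ, IsLabelling G x σ := ⟨σ, hσ⟩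
  rw [tau, dif_pos h]
  have hc := h.choose_spec
  exact le_antisymm (tauFormula_le hx hc hσ.1 hσ.2.1) (tauFormula_le hx hσ hc.1 hc.2.1)

lemma IsSparse.tau_le (hG : IsSparse G) (hx : ∀ k, 0 ≤ x k) {n n' p p' : Fin 4}
    (hn : [n, n', p, p'].Nodup) (hmax : ∀ k, x k ≤ x n) (hadj : ¬ G.Adj n n') :
    tau G x ≤ core (x n) (x n') (x p) (x p') := by
  obtain ⟨σ, hσ⟩ := hG.exists_isLabelling x
  obtain ⟨τ, rfl, rfl, rfl, rfl⟩ := exists_perm_of_nodup hn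
  rw [tau_eq hx hσ]
  exact tauFormula_le hx hσ hmax hadj

lemma IsSparse.exists_labels (hG : IsSparse G) (hx : ∀ k, 0 ≤ x k) :
    ∃ n n' p p', [n, n', p, p'].Nodup ∧ (∀ k, x k ≤ x n) ∧ ¬ G.Adj n n' ∧
      (∀ k, k ≠ n → ¬ G.Adj n k → x k ≤ x n') ∧
        tau G x = core (x n) (x n') (x p) (x p') := by
  obtain ⟨σ, hσ⟩ := hG.exists_isLabelling x
  exact ⟨_, _, _, _, nodup_of_perm σ, hσ.1, hσ.2.1, hσ.2.2, tau_eq hx hσ⟩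

lemma IsSparse.tau_nonneg (hG : IsSparse G) (hx : ∀ k, 0 ≤ x k) : 0 ≤ tau G x := by
  obtain ⟨n, n', p, p', -, hmax, -, -, h⟩ := hG.exists_labels hx
  exact h ▸ core_nonneg (hx _) (hx _) (hx _) (hmax _)

lemma IsSparse.tau_smul (hG : IsSparse G) (hx : ∀ k, 0 ≤ x k) {s : ℝ} (hs : 0 < s) :
    tau G (s • x) = s * tau G x := by
  obtain ⟨σ, hσ⟩ := hG.exists_isLabelling x
  have hσ' : IsLabelling G (s • x) σ :=
    ⟨fun k => mul_le_mul_of_nonneg_left (hσ.1 k) hs.le, hσ.2.1,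
      fun k hk hk' => mul_le_mul_of_nonneg_left (hσ.2.2 k hk hk') hs.le⟩
  rw [tau_eq hx hσ, tau_eq (x := s • x) (fun k => mul_nonneg hs.le (hx k)) hσ']
  exact core_smul hs.ne' ..

lemma IsSparse.tau_eq_zero (hG : IsSparse G) (hx : ∀ k, 0 ≤ x k) {k : Fin 4}
    (h : ∀ j, j ≠ k → x j = 0) : tau G x = 0 := by
  obtain ⟨n, n', p, p', hn, hmax, -, -, e⟩ := hG.exists_labels hx
  have h0 : ∀ j, j ≠ n → x j = 0 := by
    intro j hj
    by_cases hjk : j = k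
    · subst hjk
      exact le_antisymm (h n hj.symm ▸ hmax j) (hx j)
    · exact h j hjk
  rw [e, h0 p (by simp at hn; tauto), h0 p' (by simp at hn; tauto)]
  simp [core]

/-- The components of a state of two parties connected by an edge. -/
lemma IsSparse.tau_eq_of_adj (hG : IsSparse G) (hx : ∀ k, 0 ≤ x k) {i j : Fin 4}
    (hij : G.Adj i j) (hji : x j ≤ x i) (h : ∀ k, k ≠ i → k ≠ j → x k = 0) :
    tau G x = 2 * x j := by
  obtain ⟨r, hr, hir⟩ := hG.exists_not_adj i
  have hrj : r ≠ j := fun e => hir (e ▸ hij)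
  obtain ⟨p, hp⟩ : ∃ p, [i, r, j, p].Nodup := by
    have := hij.ne
    clear hG hx hij hji h hir
    revert i j r
    decide
  obtain ⟨σ, rfl, rfl, rfl, rfl⟩ := exists_perm_of_nodup hp
  have hmax : ∀ k, x k ≤ x (σ 0) := by
    intro k
    by_cases hki : k = σ 0
    · rw [hki]
    by_cases hkj : k = σ 2
    · rwa [hkj]
    · rw [h k hki hkj]; exact hx _
  have hσ : IsLabelling G x σ := by
    refine ⟨hmax, hir, fun k hk hk' => ?_⟩
    rw [h k hk fun e => hk' (e ▸ hij)]
    exact hx _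
  rw [tau_eq hx hσ, tauFormula, h (σ 1) (by simp) (by simp), h (σ 3) (by simp) (by simp)]
  simp

lemma IsSparse.tau_eq_of_not_adj (hG : IsSparse G) (hx : ∀ k, 0 ≤ x k) {i j : Fin 4}
    (hne : i ≠ j) (hij : ¬ G.Adj i j) (h : ∀ k, k ≠ i → k ≠ j → x k = 0) :
    tau G x = 0 := by
  wlog hji : x j ≤ x i generalizing i j
  · exact this hne.symm (fun e => hij e.symm) (fun k h1 h2 => h k h2 h1) (le_of_not_ge hji)
  obtain ⟨p, p', hp⟩ := exists_nodup hne
  have hmax : ∀ k, x k ≤ x i := by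
    intro k
    by_cases hki : k = i
    · rw [hki]
    by_cases hkj : k = j
    · rwa [hkj]
    · rw [h k hki hkj]; exact hx _
  refine le_antisymm ((hG.tau_le hx hp hmax hij).trans_eq ?_) (hG.tau_nonneg hx)
  rw [h p (by simp at hp; tauto) (by simp at hp; tauto),
    h p' (by simp at hp; tauto) (by simp at hp; tauto)]
  simp [core]

/-- Comparison of `τ` with the formula for the pairing `{n, n'}, {p, p'}` after the component of
`p` has become the largest one. -/
lemma IsSparse.tau_le_of_max_other (hG : IsSparse G) (hx : ∀ k, 0 ≤ x k) {n n' p p' : Fin 4}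
    (hn : [n, n', p, p'].Nodup) (hmax : ∀ k, x k ≤ x p) (hpn : ¬ G.Adj p n → x p' ≤ x n)
    (hpn' : ¬ G.Adj p' n → x p' ≤ x n') :
    tau G x ≤ core (x p) (x p') (x n) (x n') := by
  -- If `p'` is not joined to `p`, it is an admissible opposite party. Otherwise another
  -- non-neighbour of `p` is used and exchanged with `p'`. When `p` is joined to both `p'` and `n`,
  -- that non-neighbour must be `n'`, and triangle-freeness supplies the premise of `hpn'`.
  by_cases h1 : G.Adj p p'
  · by_cases h2 : G.Adj p n
    · have h3 : ¬ G.Adj p n' := by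
        obtain ⟨w, hw, hpw⟩ := hG.exists_not_adj p
        rcases nodup_cover hn w with rfl | rfl | rfl | rfl <;> tauto
      refine (hG.tau_le hx (n := p) (n' := n') (p := p') (p' := n) (by simp at hn ⊢; tauto)
        hmax h3).trans ?_
      rw [core_comm (x p) (x p')]
      exact core_exchange_le (hx _) (hmax _) (hpn' (hG.not_triangle _ _ _ h1.symm h2))
    · refine (hG.tau_le hx (n := p) (n' := n) (p := p') (p' := n') (by simp at hn ⊢; tauto)
        hmax h2).trans ?_
      exact core_exchange_le (hx _) (hmax _) (hpn h2)
  · exact hG.tau_le hx (by simp at hn ⊢; tauto) hmax h1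

/-! ### Supporting lines and the effect of one measurement -/

/-- `τ` has a supporting line of nonnegative slope in each component. -/
lemma IsSparse.exists_slope (hG : IsSparse G) (hx : ∀ k, 0 ≤ x k) (k : Fin 4) :
    ∃ g, 0 ≤ g ∧ ∀ t, 0 ≤ t → tau G (Function.update x k t) ≤ tau G x + g * (t - x k) := by
  obtain ⟨n, n', p, p', hn, hmax, hadj, hopt, e⟩ := hG.exists_labels hx
  rcases (hx n).eq_or_lt with h0 | h0
  · refine ⟨0, le_rfl, fun t ht => ?_⟩
    have hz : ∀ j, x j = 0 := fun j => le_antisymm (h0 ▸ hmax j) (hx j)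
    rw [hG.tau_eq_zero (k := k)]
    · simpa using hG.tau_nonneg hx
    · intro j
      by_cases hj : j = k
      · subst hj; simpa
      · simp [hj, hz]
    · intro j hj; simp [hj, hz]
  -- By homogeneity the slope is unchanged when the vector is rescaled to maximal component `1`.
  wlog h1 : x n = 1 generalizing x
  · have hy : ∀ k, 0 ≤ ((x n)⁻¹ • x) k := fun k => mul_nonneg (inv_nonneg.2 h0.le) (hx k)
    have hs := inv_pos.2 h0
    obtain ⟨g, hg, h⟩ := this (x := (x n)⁻¹ • x) hy
      (fun k => mul_le_mul_of_nonneg_left (hmax k) hs.le)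
      (fun k hk hk' => mul_le_mul_of_nonneg_left (hopt k hk hk') hs.le)
      (by rw [hG.tau_smul hx hs, e, ← core_smul hs.ne']; rfl)
      (by simp [h0.ne']) (by simp [h0.ne'])
    refine ⟨g, hg, fun t ht => ?_⟩
    have h2 := h ((x n)⁻¹ * t) (mul_nonneg hs.le ht)
    have hu : Function.update ((x n)⁻¹ • x) k ((x n)⁻¹ * t)
        = (x n)⁻¹ • Function.update x k t := by
      ext j
      by_cases hj : j = k
      · subst hj; simp
      · simp [hj]
    have hx' : ∀ j, 0 ≤ Function.update x k t j := by
      intro j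
      by_cases hj : j = k
      · subst hj; simpa
      · simpa [hj] using hx j
    rw [hu, hG.tau_smul hx hs, hG.tau_smul hx' hs, Pi.smul_apply, smul_eq_mul, ← mul_sub,
      mul_left_comm, ← mul_add] at h2
    exact le_of_mul_le_mul_left h2 hs
  have hle : ∀ j, x j ≤ 1 := fun j => h1 ▸ hmax j
  have hx' : ∀ t, 0 ≤ t → ∀ j, 0 ≤ Function.update x k t j := by
    intro t ht j
    by_cases hj : j = k
    · subst hj; simpa
    · simpa [hj] using hx j
  rw [e, h1]
  have hother : ∀ p p', [n, n', p, p'].Nodup → k = p → ∃ g, 0 ≤ g ∧ ∀ t, 0 ≤ t →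
      tau G (Function.update x k t) ≤ core 1 (x n') (x p) (x p') + g * (t - x k) := by
    rintro p p' hn rfl
    have := hx p'; have := hx n'; have := hle p'; have := hle n'
    have hd := hn
    simp only [List.nodup_cons, List.mem_cons, List.not_mem_nil, or_false, not_or] at hd
    refine ⟨2 - 2 * x p' + 2 / 3 * (x n' * x p'), by nlinarith [mul_nonneg ‹0 ≤ x n'› ‹0 ≤ x p'›],
      fun t ht => ?_⟩
    have en : Function.update x k t n = 1 := by rw [Function.update_of_ne (by tauto), h1]
    have en' : Function.update x k t n' = x n' := Function.update_of_ne (by tauto) ..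
    have ep' : Function.update x k t p' = x p' := Function.update_of_ne (by tauto) ..
    have ek : Function.update x k t k = t := Function.update_self ..
    rcases le_total t 1 with ht1 | ht1
    · refine (hG.tau_le (hx' t ht) hn (fun j => ?_) hadj).trans_eq ?_
      · by_cases hj : j = k
        · rwa [hj, en, ek]
        · rw [en, Function.update_of_ne hj]; exact hle j
      · rw [en, en', ek, ep', core_one, core_one]; ring
    · refine (hG.tau_le_of_max_other (hx' t ht) hn (fun j => ?_) (fun _ => ?_)
        (fun h => ?_)).trans ?_
      · by_cases hj : j = k
        · rw [hj]
        · rw [ek, Function.update_of_ne hj]; exact (hle j).trans ht1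
      · rw [en, ep']; exact hle p'
      · rw [en', ep']; exact hopt p' (by tauto) (fun h' => h h'.symm)
      · rw [en, en', ek, ep']
        exact core_line_other ‹_› ‹_› ‹_› ‹_› ht1
  have hd := hn
  simp only [List.nodup_cons, List.mem_cons, List.not_mem_nil, or_false, not_or] at hd
  have hn2 : [n', n, p, p'].Nodup := by simp at hn ⊢; tauto
  rcases nodup_cover hn k with rfl | rfl | rfl | rfl
  · refine ⟨2 * (x p * x p') - 4 / 3 * (x n' * x p * x p'), ?_, fun t ht => ?_⟩
    · have := mul_nonneg (hx p) (hx p')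
      nlinarith [hle n']
    have en' : Function.update x k t n' = x n' := Function.update_of_ne (by tauto) ..
    have ep : Function.update x k t p = x p := Function.update_of_ne (by tauto) ..
    have ep' : Function.update x k t p' = x p' := Function.update_of_ne (by tauto) ..
    have ek : Function.update x k t k = t := Function.update_self ..
    have hxu := hx' t ht
    rw [h1]
    generalize hy : Function.update x k t = y at *
    obtain ⟨m, -, hm⟩ := Finset.exists_max_image Finset.univ y Finset.univ_nonempty
    replace hm : ∀ j, y j ≤ y m := fun j => hm j (Finset.mem_univ j)
    rcases (hxu m).eq_or_lt with hm0 | hm0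
    · have hz : ∀ j, y j = 0 := fun j => le_antisymm (hm0 ▸ hm j) (hxu j)
      rw [hG.tau_eq_zero hxu (k := k) (fun j _ => hz j), ← ep, ← ep', ← en', hz, hz, hz]
      simp [core]
    -- Ties are settled in favour of `n'`. In the remaining cases a new maximal party `p` must be
    -- joined to `k`: otherwise `hopt` would bound its component by that of `n'`, making `n'`
    -- maximal too.
    by_cases hmn' : ∀ j, y j ≤ y n'
    · refine (hG.tau_le hxu hn2 hmn' (fun h => hadj h.symm)).trans ?_
      rw [en', ek, ep, ep']
      exact core_line_max_opposite (by rw [← en']; exact hm0.trans_le (hmn' m)) (hx _) (hx _)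
        (hle _) (by rw [← en', ← ek]; exact hmn' k)
    have hmax_other : ∀ p p', [k, n', p, p'].Nodup → y p = x p → y p' = x p' → m = p →
        tau G y ≤ core 1 (x n') (x p) (x p')
          + (2 * (x p * x p') - 4 / 3 * (x n' * x p * x p')) * (t - 1) := by
      rintro p p' hn ep ep' rfl
      have hd := hn
      simp only [List.nodup_cons, List.mem_cons, List.not_mem_nil, or_false, not_or] at hd
      refine (hG.tau_le_of_max_other hxu hn hm (fun h => ?_) (fun h => ?_)).trans ?_
      · refine absurd (fun j => (hm j).trans ?_) hmn'
        rw [ep, en']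
        exact hopt m (by tauto) (fun h' => h h'.symm)
      · rw [en', ep']; exact hopt p' (by tauto) (fun h' => h h'.symm)
      · rw [ek, en', ep, ep']
        exact core_line_max_other (hx _) (ep ▸ hm0) (hx _) (hle _)
          (by rw [← en', ← ep]; exact hm _) (by rw [← ep, ← ep']; exact hm _) ht
          (by rw [← ek, ← ep]; exact hm _)
    rcases nodup_cover hn m with rfl | rfl | rfl | rfl
    · refine (hG.tau_le hxu hn hm hadj).trans ?_
      rw [en', ek, ep, ep']
      exact core_line_max (hx _) (hx _) (hle _) (ek ▸ hm0) (by rw [← en', ← ek]; exact hm _)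
    · exact absurd hm hmn'
    · exact hmax_other _ _ hn ep ep' rfl
    · rw [core_comm, mul_comm (x p), mul_right_comm (x n')]
      exact hmax_other _ _ (by simp at hn ⊢; tauto) ep' ep rfl
  · refine ⟨2 / 3 * (x p * x p'), by have := hx p; have := hx p'; positivity, fun t ht => ?_⟩
    have en : Function.update x k t n = 1 := by rw [Function.update_of_ne (by tauto), h1]
    have ep : Function.update x k t p = x p := Function.update_of_ne (by tauto) ..
    have ep' : Function.update x k t p' = x p' := Function.update_of_ne (by tauto) ..
    have ek : Function.update x k t k = t := Function.update_self ..
    rcases le_total t 1 with ht1 | ht1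
    · refine (hG.tau_le (hx' t ht) hn (fun j => ?_) hadj).trans_eq ?_
      · by_cases hj : j = k
        · rwa [hj, en, ek]
        · rw [en, Function.update_of_ne hj]; exact hle j
      · rw [en, ek, ep, ep', core_one, core_one]; ring
    · refine (hG.tau_le (hx' t ht) hn2 (fun j => ?_) (fun h => hadj h.symm)).trans ?_
      · by_cases hj : j = k
        · rw [hj]
        · rw [ek, Function.update_of_ne hj]; exact (hle j).trans ht1
      · rw [en, ek, ep, ep']
        exact core_line_opposite (hx _) (hx _) ht1
  · exact hother _ _ hn rfl
  · rw [core_comm]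
    exact hother _ _ (by simp at hn ⊢; tauto) rfl

/-- The effect on `τ` of a measurement by party `k` on the components of a W-class state. -/
lemma IsSparse.sum_tau_le (hG : IsSparse G) (hx : ∀ k, 0 ≤ x k) (k : Fin 4) {n : ℕ}
    {s t : Fin n → ℝ} (hs : ∀ i, 0 ≤ s i) (ht : ∀ i, 0 ≤ t i) (hs1 : ∑ i, s i = 1)
    (ht1 : ∑ i, t i ≤ 1) :
    ∑ i, tau G (Function.update (s i • x) k (t i * x k)) ≤ tau G x := by
  obtain ⟨g, hg, h⟩ := hG.exists_slope hx k
  have key : ∀ i, tau G (Function.update (s i • x) k (t i * x k))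
      ≤ s i * tau G x + g * x k * (t i - s i) := by
    intro i
    have htx := mul_nonneg (ht i) (hx k)
    -- When `s i = 0` no rescaling is possible, but then only component `k` can survive and `τ`
    -- vanishes.
    rcases (hs i).eq_or_lt with h0 | h0
    · rw [← h0, zero_smul, hG.tau_eq_zero (k := k)]
      · have := mul_nonneg hg htx
        linarith
      · intro j
        by_cases hj : j = k
        · subst hj; simpa
        · simp [hj]
      · intro j hj; simp [hj]
    · have hq : 0 ≤ t i * x k / s i := div_nonneg htx h0.le
      have hu : Function.update (s i • x) k (t i * x k)
          = s i • Function.update x k (t i * x k / s i) := by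
        ext j
        by_cases hj : j = k
        · subst hj; simp; field_simp
        · simp [hj]
      rw [hu, hG.tau_smul _ h0]
      · refine (mul_le_mul_of_nonneg_left (h _ hq) h0.le).trans_eq ?_
        field_simp
      · intro j
        by_cases hj : j = k
        · subst hj; simpa
        · simpa [hj] using hx j
  refine (Finset.sum_le_sum fun i _ => key i).trans ?_
  rw [Finset.sum_add_distrib, ← Finset.sum_mul, ← Finset.mul_sum, Finset.sum_sub_distrib, hs1]
  have := mul_nonneg (mul_nonneg hg (hx k)) (sub_nonneg.2 ht1)
  linarith

/-! ### Comparison of different component vectors of one state -/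

/-- The products of the components bound `τ` for vectors that satisfy the convention on states
with exactly two nonzero components. -/
lemma IsSparse.tau_le_of_mul_eq (hG : IsSparse G) {y : Fin 4 → ℝ} (hx : IsVector x)
    (hy : IsVector y)
    (hyc : ∀ i j, i < j → y i ≠ 0 → y j ≠ 0 → (∀ k, k ≠ i → k ≠ j → y k = 0) → ∑ k, y k = 1)
    (h : ∀ i j, i ≠ j → y i * y j = x i * x j) : tau G y ≤ tau G x := by
  by_cases h1 : ∃ i j, i ≠ j ∧ x i ≠ 0 ∧ x j ≠ 0
  swap
  · push Not at h1
    have h2 : ∃ k, ∀ j, j ≠ k → y j = 0 := by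
      by_cases h3 : ∃ k, y k ≠ 0
      · obtain ⟨k, hk⟩ := h3
        refine ⟨k, fun j hj => ?_⟩
        have := h j k hj
        by_cases hxj : x j = 0
        · simpa [hxj, hk] using this
        · simpa [h1 j k hj hxj, hk] using this
      · push Not at h3
        exact ⟨0, fun j _ => h3 j⟩
    obtain ⟨k, hk⟩ := h2
    rw [hG.tau_eq_zero hy.1 hk]
    exact hG.tau_nonneg hx.1
  obtain ⟨i, j, hij, hi, hj⟩ := h1
  have hi' := (hx.1 i).lt_of_ne' hi
  have hj' := (hx.1 j).lt_of_ne' hj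
  by_cases h2 : ∃ k, k ≠ i ∧ k ≠ j ∧ x k ≠ 0
  · obtain ⟨k, hki, hkj, hk⟩ := h2
    have hk' := (hx.1 k).lt_of_ne' hk
    have e1 := h i j hij
    have e2 := h i k hki.symm
    have e3 := h j k hkj.symm
    -- With three nonzero components, `x i ^ 2` is the quotient `(x i * x j) * (x i * x k) / (x j *
    -- x k)` of the given products.
    have key : y i = x i := by
      have : y i ^ 2 * (x j * x k) = x i ^ 2 * (x j * x k) := by
        rw [← e3]
        linear_combination y i * y k * e1 + x i * x j * e2 + (x i ^ 2) * (-e3)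
      exact (pow_left_inj₀ (hy.1 i) (hx.1 i) two_ne_zero).1
        (mul_right_cancel₀ (mul_pos hj' hk').ne' this)
    have : y = x := by
      ext l
      by_cases hl : l = i
      · rw [hl, key]
      · have := h i l (Ne.symm hl)
        rw [key] at this
        exact mul_left_cancel₀ hi this
    rw [this]
  push Not at h2
  have hyi : y i ≠ 0 := fun e => (mul_pos hi' hj').ne' (by rw [← h i j hij, e, zero_mul])
  have hyj : y j ≠ 0 := fun e => (mul_pos hi' hj').ne' (by rw [← h i j hij, e, mul_zero])
  have h2' : ∀ k, k ≠ i → k ≠ j → y k = 0 := by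
    intro k hki hkj
    have := h i k hki.symm
    simpa [h2 k hki hkj, hyi] using this
  have hsum : ∀ z : Fin 4 → ℝ, (∀ k, k ≠ i → k ≠ j → z k = 0) → ∑ k, z k = z i + z j :=
    fun z hz => Fintype.sum_eq_add i j hij fun k hk => hz k hk.1 hk.2
  have hy1 : y i + y j = 1 := by
    rw [← hsum y h2']
    rcases lt_or_gt_of_ne hij with hlt | hlt
    · exact hyc i j hlt hyi hyj h2'
    · exact hyc j i hlt hyj hyi fun k h1 h3 => h2' k h3 h1
  have hx1 : x i + x j ≤ 1 := hsum x h2 ▸ hx.2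
  by_cases hadj : G.Adj i j
  · have htau : ∀ z : Fin 4 → ℝ, (∀ k, 0 ≤ z k) → (∀ k, k ≠ i → k ≠ j → z k = 0) →
        tau G z = 2 * min (z i) (z j) := by
      intro z hz hz0
      rcases le_total (z i) (z j) with hle | hle
      · rw [min_eq_left hle]
        exact hG.tau_eq_of_adj hz hadj.symm hle fun k h1 h3 => hz0 k h3 h1
      · rw [min_eq_right hle]
        exact hG.tau_eq_of_adj hz hadj hle hz0
    rw [htau y hy.1 h2', htau x hx.1 h2]
    have e := h i j hij
    -- For a fixed product, a larger sum means a smaller minimum: if `m`, the minimum for `x`, were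
    -- below `y i` and `y j`, then `0 < (y i - m) * (y j - m) ≤ (x i - m) * (x j - m) = 0`.
    have : min (y i) (y j) ≤ min (x i) (x j) := by
      by_contra hlt
      rw [not_le, lt_min_iff, min_lt_iff, min_lt_iff] at hlt
      obtain ⟨ha, hb⟩ := hlt
      have : y j = 1 - y i := by linarith
      rw [this] at e hb
      rcases ha with ha | ha <;> rcases hb with hb | hb <;>
        nlinarith [mul_pos (sub_pos.2 ha) (sub_pos.2 hb)]
    linarith
  · rw [hG.tau_eq_of_not_adj hy.1 hij hadj h2', hG.tau_eq_of_not_adj hx.1 hij hadj h2]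

end Tau

/-! ### Local operators -/

/-- The tensor product of four matrices, applied to a vector. -/
noncomputable def localMap {m d : ℕ} (V : Fin 4 → Matrix (Fin d) (Fin m) ℂ) (φ : State m) : State d :=
  fun s => ∑ t : Fin 4 → Fin m, (∏ k, V k (s k) (t k)) * φ t

lemma tensorMap_eq_localMap {d : ℕ} (V : Fin 4 → Matrix (Fin d) (Fin 2) ℂ) (φ : State 2) :
    tensorMap V φ = localMap V φ := rfl

section LocalMap

variable {l m d : ℕ}

lemma localMap_localMap (W : Fin 4 → Matrix (Fin d) (Fin m) ℂ) (V : Fin 4 → Matrix (Fin m) (Fin l) ℂ)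
    (φ : State l) : localMap W (localMap V φ) = localMap (fun k => W k * V k) φ := by
  ext s
  simp only [localMap, Matrix.mul_apply, Finset.prod_univ_sum, Fintype.piFinset_univ,
    Finset.mul_sum, Finset.sum_mul, Finset.prod_mul_distrib]
  rw [Finset.sum_comm]
  simp only [mul_assoc]

lemma localMap_one (φ : State m) : localMap (fun _ => 1) φ = φ := by
  ext s
  rw [localMap, Finset.sum_eq_single s]
  · simp
  · intro t _ hts
    obtain ⟨k, hk⟩ := Function.ne_iff.1 hts
    refine mul_eq_zero_of_left (Finset.prod_eq_zero (Finset.mem_univ k) ?_) _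
    exact Matrix.one_apply_ne hk.symm
  · simp

lemma localMap_smul (V : Fin 4 → Matrix (Fin d) (Fin m) ℂ) (c : ℂ) (φ : State m) :
    localMap V (c • φ) = c • localMap V φ := by
  ext s
  simp only [localMap, Pi.smul_apply, smul_eq_mul, Finset.mul_sum]
  exact Finset.sum_congr rfl fun t _ => by ring

lemma sum_star_mul_localMap (V : Fin 4 → Matrix (Fin d) (Fin m) ℂ) (φ : State m) (χ : State d) :
    ∑ s, star (χ s) * localMap V φ s = ∑ t, star (localMap (fun k => (V k)ᴴ) χ t) * φ t := by
  simp only [localMap, Finset.mul_sum, Finset.sum_mul, star_sum, star_mul', star_prod,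
    Matrix.conjTranspose_apply, star_star]
  rw [Finset.sum_comm]
  exact Finset.sum_congr rfl fun t _ => Finset.sum_congr rfl fun s _ => by ring

lemma normSq_eq_sum (φ : State m) : (normSq φ : ℂ) = ∑ s, star (φ s) * φ s := by
  simp only [normSq, Complex.ofReal_sum, Complex.ofReal_pow]
  exact Finset.sum_congr rfl fun s _ => (Complex.conj_mul' _).symm

lemma normSq_localMap {V : Fin 4 → Matrix (Fin d) (Fin m) ℂ} (hV : ∀ k, (V k)ᴴ * V k = 1)
    (φ : State m) : normSq (localMap V φ) = normSq φ := by
  have : (normSq (localMap V φ) : ℂ) = normSq φ := by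
    rw [normSq_eq_sum, sum_star_mul_localMap, localMap_localMap, normSq_eq_sum]
    simp only [hV, localMap_one]
  exact_mod_cast this

lemma applyLocal_localMap (k : Fin 4) (M : Matrix (Fin d) (Fin d) ℂ)
    (V : Fin 4 → Matrix (Fin d) (Fin m) ℂ) (φ : State m) :
    applyLocal k M (localMap V φ) = localMap (Function.update V k (M * V k)) φ := by
  ext s
  simp only [applyLocal, localMap, Finset.mul_sum]
  rw [Finset.sum_comm]
  refine Finset.sum_congr rfl fun t _ => ?_
  rw [← Finset.mul_prod_erase _ _ (Finset.mem_univ k)]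
  simp only [Function.update_self, Matrix.mul_apply, Finset.sum_mul]
  refine Finset.sum_congr rfl fun a _ => ?_
  rw [← Finset.mul_prod_erase _ _ (Finset.mem_univ k)]
  simp only [Function.update_self]
  rw [Finset.prod_congr rfl (g := fun j => Function.update V k (M * V k) j (s j) (t j))]
  · ring
  · intro j hj
    have := Finset.ne_of_mem_erase hj
    simp [this]

lemma localMap_update_one (k : Fin 4) (R : Matrix (Fin m) (Fin m) ℂ) (φ : State m) :
    localMap (Function.update (fun _ => 1) k R) φ = applyLocal k R φ := by
  conv_rhs => rw [← localMap_one φ]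
  rw [applyLocal_localMap, mul_one]

lemma localMap_update_mul (V : Fin 4 → Matrix (Fin d) (Fin m) ℂ) (k : Fin 4)
    (U : Matrix (Fin d) (Fin m) ℂ) (R : Matrix (Fin m) (Fin m) ℂ) (φ : State m) :
    localMap (Function.update V k (U * R)) φ
      = localMap (Function.update V k U) (applyLocal k R φ) := by
  rw [← localMap_update_one, localMap_localMap]
  congr 1
  ext j : 1
  by_cases hj : j = k
  · subst hj; simp
  · simp [hj]

end LocalMap

/-- Local isometries. -/
def IsLocalIsometry {m d : ℕ} (V : Fin 4 → Matrix (Fin d) (Fin m) ℂ) : Prop :=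
  ∀ k, (V k)ᴴ * V k = 1

lemma IsLocalIsometry.mul {l m d : ℕ} {W : Fin 4 → Matrix (Fin d) (Fin m) ℂ}
    {V : Fin 4 → Matrix (Fin m) (Fin l) ℂ} (hW : IsLocalIsometry W) (hV : IsLocalIsometry V) :
    IsLocalIsometry fun k => W k * V k := fun k => by
  rw [conjTranspose_mul, Matrix.mul_assoc, ← Matrix.mul_assoc _ (W k), hW k, Matrix.one_mul, hV k]

lemma IsLocalIsometry.update {m d : ℕ} {V : Fin 4 → Matrix (Fin d) (Fin m) ℂ}
    (hV : IsLocalIsometry V) (k : Fin 4) {U : Matrix (Fin d) (Fin m) ℂ} (hU : Uᴴ * U = 1) :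
    IsLocalIsometry (Function.update V k U) := fun j => by
  by_cases hj : j = k
  · subst hj; simpa using hU
  · simpa [hj] using hV j

lemma LocallyEquivalent.trans {d : ℕ} {ψ : State d} {φ χ : State 2} (h : LocallyEquivalent ψ φ)
    (h' : LocallyEquivalent φ χ) : LocallyEquivalent ψ χ := by
  obtain ⟨V, hV, rfl⟩ := h
  obtain ⟨W, hW, rfl⟩ := h'
  exact ⟨_, IsLocalIsometry.mul hV hW, localMap_localMap V W χ⟩

lemma isLocalIsometry_one {m : ℕ} :
    IsLocalIsometry (fun _ => 1 : Fin 4 → Matrix (Fin m) (Fin m) ℂ) := fun k => by simp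

lemma locallyEquivalent_applyLocal (k : Fin 4) {U : Matrix (Fin 2) (Fin 2) ℂ} (hU : Uᴴ * U = 1)
    (φ : State 2) : LocallyEquivalent (applyLocal k U φ) φ :=
  ⟨_, isLocalIsometry_one.update k hU, (localMap_update_one k U φ).symm⟩

/-- The `QR` decomposition of an isometry followed by a matrix. -/
lemma exists_qr {d : ℕ} {V : Matrix (Fin d) (Fin 2) ℂ} (hV : Vᴴ * V = 1)
    (B : Matrix (Fin d) (Fin 2) ℂ) :
    ∃ (U : Matrix (Fin d) (Fin 2) ℂ) (R : Matrix (Fin 2) (Fin 2) ℂ),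
      Uᴴ * U = 1 ∧ B = U * R ∧ R 1 0 = 0 := by
  have hd : 2 ≤ d := by
    have h1 := congrArg Matrix.rank hV
    have h2 := Matrix.rank_mul_le_right Vᴴ V
    rw [h1, Matrix.rank_one] at h2
    simpa using h2.trans V.rank_le_card_height
  obtain ⟨e, rfl⟩ := Nat.exists_eq_add_of_le' hd
  let f : Fin (e + 2) → EuclideanSpace ℂ (Fin (e + 2)) := fun i =>
    if i = 0 then WithLp.toLp 2 (fun a => B a 0) else WithLp.toLp 2 (fun a => B a 1)
  let b := InnerProductSpace.gramSchmidtOrthonormalBasis (𝕜 := ℂ) (by simp) f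
  have hb : ∀ {i j}, i < j → inner ℂ (b j) (f i) = 0 :=
    InnerProductSpace.gramSchmidtOrthonormalBasis_inv_triangular (𝕜 := ℂ) (by simp) f
  let ι : Fin 2 → Fin (e + 2) := Fin.castLE (by omega)
  have hf : ∀ j : Fin 2, f (ι j) = WithLp.toLp 2 (fun a => B a j) := by
    have h1 : ι 1 = 1 := rfl
    intro j
    fin_cases j
    · simp [f, ι]
    · simp [f, h1]
  refine ⟨.of fun a i => b (ι i) a, .of fun i j => inner ℂ (b (ι i)) (f (ι j)), ?_, ?_, ?_⟩
  · ext i j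
    have h := orthonormal_iff_ite.1 b.orthonormal (ι i) (ι j)
    rw [PiLp.inner_apply] at h
    simp only [Matrix.mul_apply, conjTranspose_apply, one_apply, of_apply]
    simpa [ι, mul_comm, Fin.ext_iff] using h
  · ext a j
    have h := congrArg (fun v : EuclideanSpace ℂ (Fin (e + 2)) => v a) (b.sum_repr' (f (ι j)))
    have h0 : ∀ i : Fin e, inner ℂ (b i.succ.succ) (f (ι j)) = 0 := fun i => hb (by
      fin_cases j <;> simp [ι, Fin.lt_def])
    rw [Fin.sum_univ_succ, Fin.sum_univ_succ] at h
    simp only [h0, zero_smul, Finset.sum_const_zero, add_zero, PiLp.add_apply,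
      PiLp.smul_apply, smul_eq_mul] at h
    have hB : B a j = (f (ι j)) a := by rw [hf]
    rw [Matrix.mul_apply, Fin.sum_univ_two, hB, ← h]
    simp only [mul_comm, of_apply]
    rfl
  · exact hb (by simp [ι, Fin.lt_def])

/-! ### Vectors in the span of `|0000⟩` and the four vectors with a single excitation -/

/-- `c|0000⟩ + z_A|1000⟩ + z_B|0100⟩ + z_C|0010⟩ + z_D|0001⟩`. -/
noncomputable def wVec (c : ℂ) (z : Fin 4 → ℂ) : State 2 := fun s =>
  if s = 0 then c else ∑ k, if s = Pi.single k 1 then z k else 0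

lemma wState_eq (x : Fin 4 → ℝ) :
    wState x = wVec (√(1 - ∑ k, x k) : ℝ) fun k => (√(x k) : ℝ) := rfl

lemma wVec_smul (a c : ℂ) (z : Fin 4 → ℂ) : a • wVec c z = wVec (a * c) fun k => a * z k := by
  ext s
  simp only [wVec, Pi.smul_apply, smul_eq_mul, mul_ite, Finset.mul_sum, mul_zero]

lemma wVec_zero (c : ℂ) (z : Fin 4 → ℂ) : wVec c z 0 = c := by simp [wVec]

lemma wVec_single (c : ℂ) (z : Fin 4 → ℂ) (k : Fin 4) : wVec c z (Pi.single k 1) = z k := by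
  rw [wVec, if_neg (by simp), Finset.sum_eq_single k]
  · simp
  · intro j _ hj
    rw [if_neg]
    intro h
    have := congrFun h k
    rw [Pi.single_eq_same, Pi.single_eq_of_ne hj.symm] at this
    exact one_ne_zero this
  · simp

lemma wVec_of_ne (c : ℂ) (z : Fin 4 → ℂ) {s : Fin 4 → Fin 2} (h0 : s ≠ 0)
    (h : ∀ k, s ≠ Pi.single k 1) : wVec c z s = 0 := by
  simp [wVec, h0, h]

lemma sum_mul_wVec (f : (Fin 4 → Fin 2) → ℂ) (c : ℂ) (z : Fin 4 → ℂ) :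
    ∑ s, f s * wVec c z s = f 0 * c + ∑ k, f (Pi.single k 1) * z k := by
  have h : ∀ s, wVec c z s
      = (if s = 0 then c else 0) + ∑ k, if s = Pi.single k 1 then z k else 0 := by
    intro s
    by_cases hs : s = 0
    · subst hs
      have : ∀ k : Fin 4, (0 : Fin 4 → Fin 2) ≠ Pi.single k 1 := by simp [eq_comm]
      simp [wVec, this]
    · simp [wVec, hs]
  simp only [h, mul_add, Finset.sum_add_distrib, Finset.mul_sum]
  rw [Finset.sum_comm (s := Finset.univ (α := Fin 4 → Fin 2))]
  simp

lemma localMap_wVec {d : ℕ} (V : Fin 4 → Matrix (Fin d) (Fin 2) ℂ) (c : ℂ) (z : Fin 4 → ℂ)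
    (s : Fin 4 → Fin d) : localMap V (wVec c z) s
      = (∏ l, V l (s l) 0) * c
        + ∑ k, (∏ l, V l (s l) ((Pi.single k 1 : Fin 4 → Fin 2) l)) * z k :=
  sum_mul_wVec (fun t => ∏ k, V k (s k) (t k)) c z

lemma normSq_wVec (c : ℂ) (z : Fin 4 → ℂ) :
    normSq (wVec c z) = ‖c‖ ^ 2 + ∑ k, ‖z k‖ ^ 2 := by
  have : (normSq (wVec c z) : ℂ) = (‖c‖ ^ 2 + ∑ k, ‖z k‖ ^ 2 : ℝ) := by
    rw [normSq_eq_sum, sum_mul_wVec (fun s => star (wVec c z s))]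
    simp only [wVec_zero, wVec_single]
    push_cast
    congr 1
    · exact Complex.conj_mul' c
    · exact Finset.sum_congr rfl fun k _ => Complex.conj_mul' (z k)
  exact_mod_cast this

lemma applyLocal_wVec (k : Fin 4) {R : Matrix (Fin 2) (Fin 2) ℂ} (hR : R 1 0 = 0) (c : ℂ)
    (z : Fin 4 → ℂ) :
    applyLocal k R (wVec c z)
      = wVec (R 0 0 * c + R 0 1 * z k) (Function.update (R 0 0 • z) k (R 1 1 * z k)) := by
  rw [← localMap_update_one]
  ext s
  rw [localMap_wVec]
  obtain ⟨a, b, e, f, rfl⟩ : ∃ a b e f, s = ![a, b, e, f] :=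
    ⟨s 0, s 1, s 2, s 3, by ext i; fin_cases i <;> rfl⟩
  have e0 : (0 : Fin 4 → Fin 2) = ![0, 0, 0, 0] := by decide
  have e1 : (Pi.single 0 1 : Fin 4 → Fin 2) = ![1, 0, 0, 0] := by decide
  have e2 : (Pi.single 1 1 : Fin 4 → Fin 2) = ![0, 1, 0, 0] := by decide
  have e3 : (Pi.single 2 1 : Fin 4 → Fin 2) = ![0, 0, 1, 0] := by decide
  have e4 : (Pi.single 3 1 : Fin 4 → Fin 2) = ![0, 0, 0, 1] := by decide
  simp only [wVec, Fin.sum_univ_four, Fin.prod_univ_four, e0, e1, e2, e3, e4]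
  fin_cases k <;> fin_cases a <;> fin_cases b <;> fin_cases e <;> fin_cases f <;>
    simp [hR, Function.update, one_apply]

/-- A (possibly unnormalised) W-class vector whose single excitations have weights `x`. -/
def HasWeights {d : ℕ} (ψ : State d) (x : Fin 4 → ℝ) : Prop :=
  ∃ (V : Fin 4 → Matrix (Fin d) (Fin 2) ℂ) (c : ℂ) (z : Fin 4 → ℂ),
    IsLocalIsometry V ∧ ψ = localMap V (wVec c z) ∧ ∀ k, ‖z k‖ ^ 2 = x k

lemma HasWeights.nonneg {d : ℕ} {ψ : State d} {x : Fin 4 → ℝ} (h : HasWeights ψ x) (k : Fin 4) :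
    0 ≤ x k := by
  obtain ⟨V, c, z, -, -, hz⟩ := h
  rw [← hz]
  positivity

lemma LocallyEquivalent.hasWeights {d : ℕ} {ψ : State d} {x : Fin 4 → ℝ} (hx : IsVector x)
    (h : LocallyEquivalent ψ (wState x)) : HasWeights ψ x := by
  obtain ⟨V, hV, rfl⟩ := h
  refine ⟨V, _, _, hV, by rw [tensorMap_eq_localMap, wState_eq], fun k => ?_⟩
  rw [Complex.norm_real, Real.norm_eq_abs, sq_abs, Real.sq_sqrt (hx.1 k)]

/-- The weights after a local measurement. -/
lemma HasWeights.measure {d : ℕ} {ψ : State d} {x : Fin 4 → ℝ} (h : HasWeights ψ x) (k : Fin 4)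
    {n : ℕ} {M : Fin n → Matrix (Fin d) (Fin d) ℂ} (hM : ∑ i, (M i)ᴴ * M i = 1) :
    ∃ s t : Fin n → ℝ, (∀ i, 0 ≤ s i) ∧ (∀ i, 0 ≤ t i) ∧ ∑ i, s i = 1 ∧ ∑ i, t i ≤ 1 ∧
      ∀ i, HasWeights (applyLocal k (M i) ψ) (Function.update (s i • x) k (t i * x k)) := by
  obtain ⟨V, c, z, hV, rfl, hz⟩ := h
  choose U R hU hUR hR using fun i => exists_qr (hV k) (M i * V k)
  have hsum : ∑ i, (R i)ᴴ * R i = 1 := by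
    have h1 : ∀ i, (R i)ᴴ * R i = (V k)ᴴ * ((M i)ᴴ * M i) * V k := by
      intro i
      have h2 : (M i * V k)ᴴ * (M i * V k) = (U i * R i)ᴴ * (U i * R i) := by rw [hUR]
      rw [conjTranspose_mul, conjTranspose_mul, Matrix.mul_assoc (R i)ᴴ, ← Matrix.mul_assoc (U i)ᴴ,
        hU, Matrix.one_mul] at h2
      rw [← h2]
      simp only [Matrix.mul_assoc]
    simp only [h1]
    rw [← Matrix.sum_mul, ← Matrix.mul_sum, hM, Matrix.mul_one, hV k]
  have hentry : ∀ j, ∑ i, (‖R i 0 j‖ ^ 2 + ‖R i 1 j‖ ^ 2) = 1 := by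
    intro j
    have h1 := congrFun (congrFun hsum j) j
    rw [Matrix.sum_apply, one_apply_eq] at h1
    have h2 : ((∑ i, (‖R i 0 j‖ ^ 2 + ‖R i 1 j‖ ^ 2) : ℝ) : ℂ) = 1 := by
      rw [← h1]
      push_cast
      refine Finset.sum_congr rfl fun i _ => ?_
      rw [Matrix.mul_apply, Fin.sum_univ_two, conjTranspose_apply, conjTranspose_apply]
      exact congrArg₂ _ (Complex.conj_mul' _).symm (Complex.conj_mul' _).symm
    exact_mod_cast h2
  refine ⟨fun i => ‖R i 0 0‖ ^ 2, fun i => ‖R i 1 1‖ ^ 2, fun i => by positivity,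
    fun i => by positivity, ?_, ?_, fun i => ?_⟩
  -- The first column of each `R i` has only its top entry, hence equality for `s`. The second
  -- column also contains `R i 0 1`, which feeds `|0000⟩`, hence only an inequality for `t`.
  · simpa [hR] using hentry 0
  · rw [← hentry 1]
    exact Finset.sum_le_sum fun i _ => by simp
  · refine ⟨Function.update V k (U i), R i 0 0 * c + R i 0 1 * z k,
      Function.update (R i 0 0 • z) k (R i 1 1 * z k), hV.update k (hU i), ?_, ?_⟩
    · rw [applyLocal_localMap, hUR, localMap_update_mul, applyLocal_wVec k (hR i)]
    · intro j
      by_cases hj : j = k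
      · subst hj; simp [mul_pow, hz]
      · simp [hj, mul_pow, hz]

/-- The weights of all outcomes of a protocol. -/
lemma HasWeights.exists_final {G : SimpleGraph (Fin 4)} (hG : IsSparse G) {d : ℕ} (L : LOCC d) :
    ∀ {ψ : State d} {x : Fin 4 → ℝ}, HasWeights ψ x →
      ∃ y : L.Outcome → Fin 4 → ℝ, (∀ o, HasWeights (L.final ψ o) (y o)) ∧
        ∑ o, tau G (y o) ≤ tau G x := by
  induction L with
  | halt =>
    intro ψ x h
    refine ⟨fun _ => x, fun _ => h, ?_⟩
    change ∑ _ : Unit, tau G x ≤ tau G x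
    simp
  | measure k n M hM next ih =>
    intro ψ x h
    obtain ⟨s, t, hs, ht, hs1, ht1, hw⟩ := h.measure k hM
    choose y hy hsum using fun i => ih i (hw i)
    refine ⟨fun o => y o.1 o.2, fun o => hy o.1 o.2, ?_⟩
    refine le_trans ?_ (hG.sum_tau_le h.nonneg k hs ht hs1 ht1)
    refine le_trans (le_of_eq ?_) (Finset.sum_le_sum fun i _ => hsum i)
    exact Fintype.sum_sigma (α := fun i => (next i).Outcome) fun o => tau G (y o.1 o.2)

/-! ### Normalisation -/

lemma exists_phase (c : ℂ) : ∃ u : ℂ, star u * u = 1 ∧ c = u * ‖c‖ := by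
  refine ⟨Complex.exp (Complex.arg c * Complex.I), ?_, ?_⟩
  · have := Complex.conj_mul' (Complex.exp (Complex.arg c * Complex.I))
    rw [Complex.norm_exp_ofReal_mul_I] at this
    simpa using this
  · rw [mul_comm, Complex.norm_mul_exp_arg_mul_I]

lemma wVec_locallyEquivalent_norm (c : ℂ) (z : Fin 4 → ℂ) :
    LocallyEquivalent (wVec c z) (wVec ‖c‖ fun k => (‖z k‖ : ℂ)) := by
  obtain ⟨u, hu, hc⟩ := exists_phase c
  choose v hv hz using fun k => exists_phase (z k)
  -- Party `0` carries the phase of `c` on its `|0⟩`. An excitation of any other party picks up this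
  -- phase as well, so those parties cancel it with `star u`.
  refine ⟨fun k => diagonal ![if k = 0 then u else 1, (if k = 0 then 1 else star u) * v k], ?_, ?_⟩
  · intro k
    rw [diagonal_conjTranspose, diagonal_mul_diagonal, ← diagonal_one]
    congr 1
    ext i
    have hu' : u * star u = 1 := by rw [mul_comm]; exact hu
    fin_cases i <;> by_cases hk : k = 0 <;> simp_all
    rw [mul_mul_mul_comm, hu', hv, one_mul]
  · rw [tensorMap_eq_localMap]
    ext s
    rw [localMap_wVec]
    obtain ⟨a, b, e, f, rfl⟩ : ∃ a b e f, s = ![a, b, e, f] :=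
      ⟨s 0, s 1, s 2, s 3, by ext i; fin_cases i <;> rfl⟩
    have e0 : (0 : Fin 4 → Fin 2) = ![0, 0, 0, 0] := by decide
    have e1 : (Pi.single 0 1 : Fin 4 → Fin 2) = ![1, 0, 0, 0] := by decide
    have e2 : (Pi.single 1 1 : Fin 4 → Fin 2) = ![0, 1, 0, 0] := by decide
    have e3 : (Pi.single 2 1 : Fin 4 → Fin 2) = ![0, 0, 1, 0] := by decide
    have e4 : (Pi.single 3 1 : Fin 4 → Fin 2) = ![0, 0, 0, 1] := by decide
    have hz' : ∀ k, u * (star u * v k) * ‖z k‖ = z k := by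
      intro k
      rw [← mul_assoc u, mul_comm u, hu, one_mul, ← hz]
    have hz0 := hz 0
    simp only [wVec, Fin.sum_univ_four, Fin.prod_univ_four, e0, e1, e2, e3, e4]
    fin_cases a <;> fin_cases b <;> fin_cases e <;> fin_cases f <;>
      simp [← hc] <;> first | exact hz0 | exact (hz' _).symm

lemma LocallyEquivalent.localMap {d : ℕ} {V : Fin 4 → Matrix (Fin d) (Fin 2) ℂ}
    (hV : IsLocalIsometry V) (φ : State 2) : LocallyEquivalent (localMap V φ) φ := ⟨V, hV, rfl⟩

lemma HasWeights.normalize {d : ℕ} {ψ : State d} {x : Fin 4 → ℝ} (h : HasWeights ψ x)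
    (h0 : normSq ψ ≠ 0) :
    IsVector ((normSq ψ)⁻¹ • x) ∧
      LocallyEquivalent (((√(normSq ψ) : ℝ) : ℂ)⁻¹ • ψ) (wState ((normSq ψ)⁻¹ • x)) := by
  have hx := h.nonneg
  obtain ⟨V, c, z, hV, rfl, hz⟩ := h
  have hn : normSq (localMap V (wVec c z)) = ‖c‖ ^ 2 + ∑ k, x k := by
    rw [normSq_localMap hV, normSq_wVec]; simp only [hz]
  generalize normSq (localMap V (wVec c z)) = p at *
  have hp : 0 < p := lt_of_le_of_ne' (hn ▸ add_nonneg (by positivity)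
    (Finset.sum_nonneg fun k _ => hx k)) h0
  have hs : 1 - ∑ k, (p⁻¹ • x) k = p⁻¹ * ‖c‖ ^ 2 := by
    simp only [Pi.smul_apply, smul_eq_mul, ← Finset.mul_sum]
    field_simp
    linarith
  refine ⟨⟨fun k => mul_nonneg (inv_nonneg.2 hp.le) (hx k), ?_⟩, ?_⟩
  · have : 0 ≤ p⁻¹ * ‖c‖ ^ 2 := by positivity
    linarith
  · rw [← localMap_smul, wVec_smul]
    refine (LocallyEquivalent.localMap hV _).trans ?_
    convert wVec_locallyEquivalent_norm _ _ using 1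
    rw [wState_eq, hs]
    have hsq : ∀ w : ℂ, √(p⁻¹ * ‖w‖ ^ 2) = ‖((√p : ℝ) : ℂ)⁻¹ * w‖ := by
      intro w
      rw [Real.sqrt_mul (by positivity), Real.sqrt_sq (norm_nonneg _), norm_mul, norm_inv,
        Complex.norm_real, Real.norm_of_nonneg (Real.sqrt_nonneg _), Real.sqrt_inv]
    simp only [hsq, Pi.smul_apply, smul_eq_mul, ← hz]

/-! ### Uniqueness of the component vector -/

lemma norm_det_le_one {U : Matrix (Fin 2) (Fin 2) ℂ}
    (h : ∀ j, ‖U 0 j‖ ^ 2 + ‖U 1 j‖ ^ 2 ≤ 1) : ‖U.det‖ ≤ 1 := by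
  rw [det_fin_two]
  refine (norm_sub_le _ _).trans ?_
  rw [norm_mul, norm_mul]
  nlinarith [h 0, h 1, sq_nonneg (‖U 0 0‖ - ‖U 1 1‖), sq_nonneg (‖U 0 1‖ - ‖U 1 0‖)]

/-- The part of `V` orthogonal to the range of `W` has Gram matrix `1 - (Wᴴ * V)ᴴ * (Wᴴ * V)`, whose
diagonal entries are nonnegative. -/
lemma column_le_one {d : ℕ} {V W : Matrix (Fin d) (Fin 2) ℂ} (hV : Vᴴ * V = 1) (hW : Wᴴ * W = 1)
    (j : Fin 2) : ‖(Wᴴ * V) 0 j‖ ^ 2 + ‖(Wᴴ * V) 1 j‖ ^ 2 ≤ 1 := by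
  have h1 : (V - W * (Wᴴ * V))ᴴ * (V - W * (Wᴴ * V)) = 1 - (Wᴴ * V)ᴴ * (Wᴴ * V) := by
    have h2 : Wᴴ * (W * (Wᴴ * V)) = Wᴴ * V := by rw [← Matrix.mul_assoc, hW, Matrix.one_mul]
    simp only [conjTranspose_sub, conjTranspose_mul, conjTranspose_conjTranspose, Matrix.sub_mul,
      Matrix.mul_sub, Matrix.mul_assoc, h2, hV]
    simp
  have h3 := congrFun (congrFun h1 j) j
  have h4 : ((∑ i, ‖(V - W * (Wᴴ * V)) i j‖ ^ 2 : ℝ) : ℂ)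
      = (1 - (‖(Wᴴ * V) 0 j‖ ^ 2 + ‖(Wᴴ * V) 1 j‖ ^ 2) : ℝ) := by
    rw [Matrix.sub_apply, one_apply_eq, Matrix.mul_apply, Matrix.mul_apply, Fin.sum_univ_two] at h3
    simp only [conjTranspose_apply] at h3
    push_cast
    simp only [← Complex.conj_mul']
    exact h3
  have h5 := Complex.ofReal_injective h4
  have h6 : 0 ≤ ∑ i, ‖(V - W * (Wᴴ * V)) i j‖ ^ 2 := Finset.sum_nonneg fun i _ => by positivity
  linarith

/-- With the other two parties projected onto `|0⟩`, parties `i` and `j` share a `2 × 2` coefficient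
matrix. The operators at `i` and `j` multiply its determinant by theirs. The other two scale both
excitations by their `0 0` entries, hence the squares, and otherwise alter only the `|00⟩`
coefficient, which does not enter. -/
lemma localMap_wVec_minor (U : Fin 4 → Matrix (Fin 2) (Fin 2) ℂ) (c : ℂ) (z : Fin 4 → ℂ)
    {i j : Fin 4} (hij : i ≠ j) :
    localMap U (wVec c z) 0 * localMap U (wVec c z) (Pi.single i 1 + Pi.single j 1)
      - localMap U (wVec c z) (Pi.single i 1) * localMap U (wVec c z) (Pi.single j 1)
      = -(∏ l, if l = i ∨ l = j then (U l).det else U l 0 0 ^ 2) * (z i * z j) := by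
  simp only [localMap_wVec, Fin.sum_univ_four, Fin.prod_univ_four, det_fin_two]
  fin_cases i <;> fin_cases j <;> first | exact absurd rfl hij | skip
  all_goals
    simp
    ring

lemma wVec_minor (c : ℂ) (z : Fin 4 → ℂ) {i j : Fin 4} (hij : i ≠ j) :
    wVec c z 0 * wVec c z (Pi.single i 1 + Pi.single j 1)
      - wVec c z (Pi.single i 1) * wVec c z (Pi.single j 1) = -(z i * z j) := by
  have h : wVec c z (Pi.single i 1 + Pi.single j 1) = 0 :=
    wVec_of_ne c z (by revert i j; decide) (by revert i j; decide)
  rw [wVec_single, wVec_single, h]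
  ring

lemma mul_le_mul_of_locallyEquivalent {d : ℕ} {ψ : State d} {x y : Fin 4 → ℝ}
    (hx : LocallyEquivalent ψ (wState x)) (hy : LocallyEquivalent ψ (wState y))
    (hx0 : ∀ k, 0 ≤ x k) (hy0 : ∀ k, 0 ≤ y k) {i j : Fin 4} (hij : i ≠ j) :
    y i * y j ≤ x i * x j := by
  obtain ⟨V, hV, rfl⟩ := hx
  obtain ⟨W, hW, h⟩ := hy
  have h1 : wState y = localMap (fun k => (W k)ᴴ * V k) (wState x) := by
    rw [← localMap_localMap, ← tensorMap_eq_localMap V, h, tensorMap_eq_localMap,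
      localMap_localMap]
    simp only [hW, localMap_one]
  rw [wState_eq, wState_eq] at h1
  have h2 := localMap_wVec_minor (fun k => (W k)ᴴ * V k) (√(1 - ∑ k, x k) : ℝ)
    (fun k => (√(x k) : ℝ)) hij
  rw [← h1, wVec_minor _ _ hij] at h2
  have hcol := fun k => column_le_one (hV k) (hW k)
  have h3 : ‖∏ l, if l = i ∨ l = j then ((W l)ᴴ * V l).det else ((W l)ᴴ * V l) 0 0 ^ 2‖ ≤ 1 := by
    rw [norm_prod]
    refine Finset.prod_le_one (fun l _ => norm_nonneg _) fun l _ => ?_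
    split_ifs
    · exact norm_det_le_one (hcol l)
    · rw [norm_pow]
      have := hcol l 0
      have : 0 ≤ ‖((W l)ᴴ * V l) 1 0‖ ^ 2 := by positivity
      linarith
  have h4 := congrArg norm h2
  rw [norm_neg, norm_mul, norm_mul, norm_neg, norm_mul, Complex.norm_real, Complex.norm_real,
    Complex.norm_real, Complex.norm_real] at h4
  simp only [Real.norm_of_nonneg (Real.sqrt_nonneg _)] at h4
  rw [← Real.sqrt_mul (hy0 i), ← Real.sqrt_mul (hx0 i)] at h4
  have h5 : √(y i * y j) ≤ √(x i * x j) :=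
    h4.trans_le (mul_le_of_le_one_left (Real.sqrt_nonneg _) h3)
  exact (Real.sqrt_le_sqrt_iff (mul_nonneg (hx0 i) (hx0 j))).1 h5

lemma IsSparse.tau_le_of_isVectorOf {G : SimpleGraph (Fin 4)} (hG : IsSparse G) {d : ℕ}
    {ψ : State d} {x y : Fin 4 → ℝ} (hx : IsVector x) (hψ : LocallyEquivalent ψ (wState x))
    (hy : IsVectorOf ψ y) : tau G y ≤ tau G x :=
  hG.tau_le_of_mul_eq hx hy.1 (fun i j hij hi hj h => (hy.2.1 i j hij hi hj h).1)
    fun _ _ hij => le_antisymm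
      (mul_le_mul_of_locallyEquivalent hψ hy.2.2 hx.1 hy.1.1 hij)
      (mul_le_mul_of_locallyEquivalent hy.2.2 hψ hy.1.1 hx.1 hij)

/-! ### States of two parties -/

/-- The parties `i` and `j` share the vector with coefficient matrix `A`, the others are in
`|0⟩`. -/
def biVec (i j : Fin 4) (A : Matrix (Fin 2) (Fin 2) ℂ) : State 2 := fun s =>
  if ∀ k, k ≠ i → k ≠ j → s k = 0 then A (s i) (s j) else 0

lemma applyLocal_left_biVec {i j : Fin 4} (hij : i ≠ j) (P A : Matrix (Fin 2) (Fin 2) ℂ) :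
    applyLocal i P (biVec i j A) = biVec i j (P * A) := by
  ext s
  have h : ∀ t, (∀ k, k ≠ i → k ≠ j → Function.update s i t k = 0) ↔
      ∀ k, k ≠ i → k ≠ j → s k = 0 := fun t =>
    forall_congr' fun k => imp_congr_right fun hk => by simp [hk]
  simp only [applyLocal, biVec, h, Function.update_self, Function.update_of_ne hij.symm,
    Matrix.mul_apply]
  split_ifs <;> simp

lemma applyLocal_right_biVec {i j : Fin 4} (hij : i ≠ j) (Q A : Matrix (Fin 2) (Fin 2) ℂ) :
    applyLocal j Q (biVec i j A) = biVec i j (A * Qᵀ) := by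
  ext s
  have h : ∀ t, (∀ k, k ≠ i → k ≠ j → Function.update s j t k = 0) ↔
      ∀ k, k ≠ i → k ≠ j → s k = 0 := fun t =>
    forall_congr' fun k => imp_congr_right fun _ => imp_congr_right fun hk => by simp [hk]
  simp only [applyLocal, biVec, h, Function.update_self, Function.update_of_ne hij,
    Matrix.mul_apply, transpose_apply]
  split_ifs <;> simp [mul_comm]

lemma wVec_eq_biVec {i j : Fin 4} (hij : i ≠ j) (c : ℂ) {z : Fin 4 → ℂ}
    (hz : ∀ k, k ≠ i → k ≠ j → z k = 0) : wVec c z = biVec i j !![c, z j; z i, 0] := by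
  ext s
  by_cases h0 : s = 0
  · subst h0; simp [wVec_zero, biVec]
  by_cases h1 : ∃ k, s = Pi.single k 1
  · obtain ⟨k, rfl⟩ := h1
    rw [wVec_single, biVec]
    by_cases hki : k = i
    · subst hki
      have h : ∀ l, l ≠ k → l ≠ j → (Pi.single k 1 : Fin 4 → Fin 2) l = 0 :=
        fun l hl _ => Pi.single_eq_of_ne hl _
      rw [if_pos h]
      simp [hij.symm]
    by_cases hkj : k = j
    · subst hkj
      have h : ∀ l, l ≠ i → l ≠ k → (Pi.single k 1 : Fin 4 → Fin 2) l = 0 :=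
        fun l _ hl => Pi.single_eq_of_ne hl _
      rw [if_pos h]
      simp [hij]
    · rw [if_neg fun h => by simpa using h k hki hkj, hz k hki hkj]
  · push Not at h1
    rw [wVec_of_ne c z h0 h1, biVec]
    split_ifs with h
    · have h2 : s i = 1 ∧ s j = 1 := by
        have h3 : ∀ k, (∀ l, l ≠ k → s l = 0) → s k = 0 ∧ False := by
          intro k hk
          exfalso
          by_cases hsk : s k = 0
          · exact h0 (funext fun l => by by_cases hl : l = k <;> simp_all)
          · refine h1 k (funext fun l => ?_)
            by_cases hl : l = k
            · subst hl; rw [Pi.single_eq_same]; omega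
            · rw [Pi.single_eq_of_ne hl, hk l hl]
        constructor
        · by_contra hi
          refine (h3 j fun l hl => ?_).2
          by_cases hli : l = i
          · subst hli; omega
          · exact h l hli hl
        · by_contra hj
          refine (h3 i fun l hl => ?_).2
          by_cases hlj : l = j
          · subst hlj; omega
          · exact h l hl hlj
      simp [h2.1, h2.2]
    · rfl

lemma biVec_locallyEquivalent {i j : Fin 4} (hij : i ≠ j) {P Q : Matrix (Fin 2) (Fin 2) ℂ}
    (hP : Pᴴ * P = 1) (hQ : Qᴴ * Q = 1) (A : Matrix (Fin 2) (Fin 2) ℂ) :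
    LocallyEquivalent (biVec i j (P * A * Qᵀ)) (biVec i j A) := by
  rw [← applyLocal_right_biVec hij, ← applyLocal_left_biVec hij]
  exact (locallyEquivalent_applyLocal j hQ _).trans (locallyEquivalent_applyLocal i hP _)

/-- Singular value decomposition of the coefficient matrix of a state of two parties. -/
lemma exists_svd (p : ℝ) {q r : ℝ} (hq : q ≠ 0) (hr : r ≠ 0) :
    ∃ (P Q : Matrix (Fin 2) (Fin 2) ℝ) (a b : ℝ), Pᵀ * P = 1 ∧ Qᵀ * Q = 1 ∧ 0 ≤ b ∧ b ≤ a ∧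
      a ^ 2 + b ^ 2 = p ^ 2 + q ^ 2 + r ^ 2 ∧ !![p, q; r, 0] = P * !![0, b; a, 0] * Qᵀ := by
  obtain ⟨c, s, hcs, horth, hle⟩ : ∃ c s : ℝ, c ^ 2 + s ^ 2 = 1 ∧
      (p * c + q * s) * (q * c - p * s) - r * c * (r * s) = 0 ∧
      (q * c - p * s) ^ 2 + (r * s) ^ 2 ≤ (p * c + q * s) ^ 2 + (r * c) ^ 2 := by
    -- This is the inner product of the two columns after a rotation by `θ`. A quarter turn reverses
    -- its sign, so some rotation makes the columns orthogonal; a further quarter turn orders their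
    -- lengths.
    let f : ℝ → ℝ := fun θ => (p * θ.cos + q * θ.sin) * (q * θ.cos - p * θ.sin)
      - r * θ.cos * (r * θ.sin)
    have hf : Continuous f := by fun_prop
    have hf0 : f 0 = p * q := by simp [f]
    have hf1 : f (Real.pi / 2) = -(p * q) := by simp [f]; ring
    obtain ⟨θ, hθ⟩ : ∃ θ, f θ = 0 := by
      rcases le_total 0 (p * q) with h | h
      · exact mem_range_of_exists_le_of_exists_ge hf ⟨Real.pi / 2, by linarith⟩ ⟨0, by linarith⟩
      · exact mem_range_of_exists_le_of_exists_ge hf ⟨0, by linarith⟩ ⟨Real.pi / 2, by linarith⟩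
    rcases le_total ((q * θ.cos - p * θ.sin) ^ 2 + (r * θ.sin) ^ 2)
      ((p * θ.cos + q * θ.sin) ^ 2 + (r * θ.cos) ^ 2) with h | h
    · exact ⟨θ.cos, θ.sin, Real.cos_sq_add_sin_sq θ, hθ, h⟩
    · refine ⟨-θ.sin, θ.cos, by rw [neg_sq]; exact Real.sin_sq_add_cos_sq θ, ?_, ?_⟩
      · linear_combination -hθ
      · nlinarith
  set A := (p * c + q * s) ^ 2 + (r * c) ^ 2 with hA
  set B := (q * c - p * s) ^ 2 + (r * s) ^ 2 with hB
  -- Lagrange's identity: for orthogonal columns the product of squared lengths is the squared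
  -- determinant, nonzero here, so both columns can be normalised.
  have hAB : A * B = q ^ 2 * r ^ 2 := by
    have : A * B = ((p * c + q * s) * (q * c - p * s) - r * c * (r * s)) ^ 2
        + (q * r * (c ^ 2 + s ^ 2)) ^ 2 := by rw [hA, hB]; ring
    rw [this, horth, hcs]; ring
  have hA0 : 0 ≤ A := by positivity
  have hB0 : 0 ≤ B := by positivity
  have hABne : A * B ≠ 0 := by rw [hAB]; positivity
  have hAp : 0 < √A := Real.sqrt_pos.2 (hA0.lt_of_ne' (left_ne_zero_of_mul hABne))
  have hBp : 0 < √B := Real.sqrt_pos.2 (hB0.lt_of_ne' (right_ne_zero_of_mul hABne))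
  have hA2 : √A ^ 2 = A := Real.sq_sqrt hA0
  have hB2 : √B ^ 2 = B := Real.sq_sqrt hB0
  refine ⟨!![(q * c - p * s) / √B, (p * c + q * s) / √A; -(r * s) / √B, r * c / √A],
    !![c, -s; s, c], √A, √B, ?_, ?_, hBp.le, Real.sqrt_le_sqrt hle, ?_, ?_⟩
  · ext i j
    fin_cases i <;> fin_cases j <;> simp [Matrix.mul_apply, Fin.sum_univ_two]
    · field_simp; rw [hB2, hB]; ring
    · field_simp; linear_combination horth
    · field_simp; linear_combination horth
    · field_simp; rw [hA2, hA]; ring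
  · ext i j
    fin_cases i <;> fin_cases j <;> simp [Matrix.mul_apply, Fin.sum_univ_two]
    · linear_combination hcs
    · ring
    · ring
    · linear_combination hcs
  · rw [hA2, hB2, hA, hB]
    linear_combination (p ^ 2 + q ^ 2 + r ^ 2) * hcs
  · ext i j
    fin_cases i <;> fin_cases j <;> simp [Matrix.mul_apply, Fin.sum_univ_two]
    · field_simp; linear_combination -p * hcs
    · field_simp; linear_combination -q * hcs
    · field_simp; linear_combination -hcs
    · field_simp; ring

lemma exists_complex_svd (p : ℝ) {q r : ℝ} (hq : q ≠ 0) (hr : r ≠ 0) :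
    ∃ (P Q : Matrix (Fin 2) (Fin 2) ℂ) (a b : ℝ), Pᴴ * P = 1 ∧ Qᴴ * Q = 1 ∧ 0 ≤ b ∧ b ≤ a ∧
      a ^ 2 + b ^ 2 = p ^ 2 + q ^ 2 + r ^ 2 ∧
        !![(p : ℂ), q; r, 0] = P * !![0, (b : ℂ); a, 0] * Qᵀ := by
  obtain ⟨P, Q, a, b, hP, hQ, hb, hba, hab, h⟩ := exists_svd p hq hr
  have hmap : ∀ P : Matrix (Fin 2) (Fin 2) ℝ, Pᵀ * P = 1 →
      (P.map Complex.ofRealHom)ᴴ * P.map Complex.ofRealHom = 1 := by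
    intro P hP
    have h1 : (P.map Complex.ofRealHom)ᴴ = Pᵀ.map Complex.ofRealHom := by
      ext i j; simp
    rw [h1, ← Matrix.map_mul, hP]
    simp
  refine ⟨P.map Complex.ofRealHom, Q.map Complex.ofRealHom, a, b, hmap P hP, hmap Q hQ, hb, hba,
    hab, ?_⟩
  have h2 := congrArg (fun A => A.map Complex.ofRealHom) h
  simp only [Matrix.map_mul] at h2
  convert h2 using 1
  · ext i j; fin_cases i <;> fin_cases j <;> simp
  · congr 2
    ext i j; fin_cases i <;> fin_cases j <;> simp

/-- Existence of the component vector. -/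
lemma LocallyEquivalent.exists_isVectorOf {d : ℕ} {ψ : State d} {x : Fin 4 → ℝ}
    (hx : IsVector x) (hψ : LocallyEquivalent ψ (wState x)) : ∃ y, IsVectorOf ψ y := by
  by_cases h : ∃ i j, i < j ∧ x i ≠ 0 ∧ x j ≠ 0 ∧ ∀ k, k ≠ i → k ≠ j → x k = 0
  swap
  · push Not at h
    refine ⟨x, hx, fun i j hij hi hj h' => ?_, hψ⟩
    obtain ⟨k, hki, hkj, hk⟩ := h i j hij hi hj
    exact absurd (h' k hki hkj) hk
  obtain ⟨i, j, hij, hi, hj, hk⟩ := h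
  have hi' := Real.sqrt_ne_zero'.2 ((hx.1 i).lt_of_ne' hi)
  have hj' := Real.sqrt_ne_zero'.2 ((hx.1 j).lt_of_ne' hj)
  obtain ⟨P, Q, a, b, hP, hQ, hb, hba, hab, hsvd⟩ :=
    exists_complex_svd (√(1 - ∑ k, x k)) hj' hi'
  have hsum : ∀ z : Fin 4 → ℝ, (∀ k, k ≠ i → k ≠ j → z k = 0) → ∑ k, z k = z i + z j :=
    fun z hz => Fintype.sum_eq_add i j hij.ne fun k hk => hz k hk.1 hk.2
  rw [Real.sq_sqrt (sub_nonneg.2 hx.2), Real.sq_sqrt (hx.1 i), Real.sq_sqrt (hx.1 j),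
    hsum x hk] at hab
  let y : Fin 4 → ℝ := fun k => if k = i then a ^ 2 else if k = j then b ^ 2 else 0
  have hyi : y i = a ^ 2 := by simp [y]
  have hyj : y j = b ^ 2 := by simp [y, hij.ne']
  have hyk : ∀ k, k ≠ i → k ≠ j → y k = 0 := fun k h1 h2 => by simp [y, h1, h2]
  have hy1 : ∑ k, y k = 1 := by rw [hsum y hyk, hyi, hyj]; linarith
  have hyji : y j ≤ y i := by rw [hyi, hyj]; exact pow_le_pow_left₀ hb hba 2
  refine ⟨y, ⟨fun k => ?_, hy1.le⟩, fun i' j' hij' hi' hj' _ => ⟨hy1, ?_⟩, hψ.trans ?_⟩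
  · simp only [y]; split_ifs <;> positivity
  · have h1 : i' = i ∨ i' = j := by by_contra h; push Not at h; exact hi' (hyk _ h.1 h.2)
    have h2 : j' = i ∨ j' = j := by by_contra h; push Not at h; exact hj' (hyk _ h.1 h.2)
    rcases h1 with rfl | rfl <;> rcases h2 with rfl | rfl
    · exact le_rfl
    · exact hyji
    · exact absurd hij' hij.not_gt
    · exact le_rfl
  · rw [wState_eq, wVec_eq_biVec hij.ne _ (fun k h1 h2 => by simp [hk k h1 h2]), hsvd, wState_eq,
      wVec_eq_biVec hij.ne _ (fun k h1 h2 => by simp [hyk k h1 h2]), hy1, hyi, hyj,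
      Real.sqrt_sq hb, Real.sqrt_sq (hb.trans hba)]
    simpa using biVec_locallyEquivalent hij.ne hP hQ _

/-! ### EPR pairs -/

/-- The component vector of an EPR pair shared by `i` and `j`. -/
noncomputable def eprVector (i j : Fin 4) : Fin 4 → ℝ := fun k => if k = i ∨ k = j then 1 / 2 else 0

lemma sum_eprVector {i j : Fin 4} (hij : i ≠ j) : ∑ k, eprVector i j k = 1 := by
  rw [Fintype.sum_eq_add i j hij fun k hk => by simp [eprVector, hk.1, hk.2]]
  norm_num [eprVector]

lemma epr_locallyEquivalent {i j : Fin 4} (hij : i ≠ j) :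
    LocallyEquivalent (epr i j) (wState (eprVector i j)) := by
  have hsum := sum_eprVector hij
  have h1 : wState (eprVector i j)
      = biVec i j !![0, (√(1 / 2) : ℝ); (√(1 / 2) : ℝ), 0] := by
    rw [wState_eq, wVec_eq_biVec hij _ (fun k h1 h2 => by simp [eprVector, h1, h2]), hsum]
    simp [eprVector]
  -- A bit flip at party `i` turns `|01⟩ + |10⟩` into `|00⟩ + |11⟩`.
  have h2 : epr i j = biVec i j (!![0, 1; 1, 0]
      * !![(0 : ℂ), (√(1 / 2) : ℝ); (√(1 / 2) : ℝ), 0] * (1 : Matrix (Fin 2) (Fin 2) ℂ)ᵀ) := by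
    ext s
    simp only [epr, biVec, ite_and]
    by_cases h : ∀ k, k ≠ i → k ≠ j → s k = 0
    · simp only [if_pos h]
      generalize s i = a
      generalize s j = b
      fin_cases a <;> fin_cases b <;> simp
    · simp only [if_neg h, ite_self]
  rw [h1, h2]
  refine biVec_locallyEquivalent hij ?_ (by simp) _
  ext a b
  fin_cases a <;> fin_cases b <;> simp [Matrix.mul_apply]

lemma IsSparse.one_le_tau {G : SimpleGraph (Fin 4)} (hG : IsSparse G) {d : ℕ} {ψ : State d}
    {x : Fin 4 → ℝ} (hx : IsVector x) (hψ : LocallyEquivalent ψ (wState x))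
    (hs : IsSuccess G ψ) : 1 ≤ tau G x := by
  obtain ⟨i, j, hij, h⟩ := hs
  have h0 : ∀ k, 0 ≤ eprVector i j k := fun k => by
    unfold eprVector; split_ifs <;> norm_num
  have hk : ∀ k, k ≠ i → k ≠ j → eprVector i j k = 0 := fun k h1 h2 => by
    simp [eprVector, h1, h2]
  have hsum := sum_eprVector hij.ne
  have h1 : tau G (eprVector i j) = 1 := by
    rw [hG.tau_eq_of_adj h0 hij (by simp [eprVector]) hk]
    simp [eprVector]
  rw [← h1]
  refine hG.tau_le_of_isVectorOf hx hψ ⟨⟨h0, hsum.le⟩, fun a b _ ha hb _ => ⟨hsum, ?_⟩,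
    h.trans (epr_locallyEquivalent hij.ne)⟩
  have : ∀ k, eprVector i j k ≠ 0 → eprVector i j k = 1 / 2 := by
    intro k hk
    unfold eprVector at hk ⊢
    split_ifs at hk ⊢ <;> simp_all
  rw [this a ha, this b hb]

/-! ### Protocols -/

variable {G : SimpleGraph (Fin 4)} {d : ℕ} {ψ : State d} {x : Fin 4 → ℝ}

/-- A quantity that is at most `τ` on each outcome is on average at most the initial `τ`. -/
lemma IsSparse.sum_prob_mul_le (hG : IsSparse G) (hx : IsVector x)
    (hψ : LocallyEquivalent ψ (wState x)) (L : LOCC d) {f : L.Outcome → ℝ}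
    (hf : ∀ o, L.prob ψ o ≠ 0 → ∀ y, IsVector y → LocallyEquivalent (L.post ψ o) (wState y) →
      f o ≤ tau G y) :
    ∑ o, L.prob ψ o * f o ≤ tau G x := by
  obtain ⟨y, hy, hsum⟩ := (hψ.hasWeights hx).exists_final hG L
  refine (Finset.sum_le_sum fun o _ => ?_).trans hsum
  by_cases h0 : L.prob ψ o = 0
  · rw [h0, zero_mul]
    exact hG.tau_nonneg (hy o).nonneg
  have hp : 0 < L.prob ψ o :=
    (Finset.sum_nonneg fun _ _ => by positivity : 0 ≤ L.prob ψ o).lt_of_ne' h0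
  obtain ⟨h1, h2⟩ := (hy o).normalize h0
  have h3 : f o ≤ tau G ((L.prob ψ o)⁻¹ • y o) := hf o h0 _ h1 h2
  rw [hG.tau_smul (hy o).nonneg (inv_pos.2 hp)] at h3
  rwa [← le_inv_mul_iff₀ hp]

lemma LOCC.exists_isVectorOf_post (hG : IsSparse G) (hx : IsVector x)
    (hψ : LocallyEquivalent ψ (wState x)) (L : LOCC d) {o : L.Outcome} (ho : L.prob ψ o ≠ 0) :
    ∃ y, IsVectorOf (L.post ψ o) y := by
  obtain ⟨y, hy, -⟩ := (hψ.hasWeights hx).exists_final hG L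
  obtain ⟨h1, h2⟩ := (hy o).normalize ho
  exact h2.exists_isVectorOf h1

lemma IsSparse.successProb_le (hG : IsSparse G) (hx : IsVector x)
    (hψ : LocallyEquivalent ψ (wState x)) (L : LOCC d) : successProb G L ψ ≤ tau G x := by
  classical
  have h := hG.sum_prob_mul_le hx hψ L (f := fun o => if IsSuccess G (L.post ψ o) then 1 else 0)
    fun o _ y hy hy' => by
      split_ifs with hs
      · exact hG.one_le_tau hy hy' hs
      · exact hG.tau_nonneg hy.1
  simpa [successProb] using h

end WClass

theorem theorem1 (G : SimpleGraph (Fin 4)) (hG : WClass.IsConfigIII G) :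
    (∀ x : Fin 4 → ℝ, WClass.IsVector x →
      (∃ σ, WClass.IsLabelling G x σ) ∧
        ∀ σ, WClass.IsLabelling G x σ → WClass.tau G x = WClass.tauFormula x σ) ∧
    (∀ (d : ℕ) (ψ : WClass.State d) (x : Fin 4 → ℝ), WClass.IsVectorOf ψ x →
      ∀ (L : WClass.LOCC d) (o : L.Outcome), L.prob ψ o ≠ 0 →
        ∃ y, WClass.IsVectorOf (L.post ψ o) y) ∧
    WClass.IsEntanglementMonotone (WClass.tau G) ∧
    (∀ x : Fin 4 → ℝ, WClass.IsVector x →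
      BddAbove (WClass.achievable (WClass.wState x) G) ∧
        WClass.optProb (WClass.wState x) G ≤ WClass.tau G x) := by
  have hs := hG.isSparse
  refine ⟨fun x hx => ⟨hs.exists_isLabelling x, fun σ hσ => WClass.tau_eq hx.1 hσ⟩,
    fun d ψ x hx L o ho => L.exists_isVectorOf_post hs hx.1 hx.2.2 ho,
    fun d ψ x hx L y hy => hs.sum_prob_mul_le hx.1 hx.2.2 L fun o ho z hz hz' =>
      hs.tau_le_of_isVectorOf hz hz' (hy o ho), fun x hx => ?_⟩
  have hle : ∀ q ∈ WClass.achievable (WClass.wState x) G, q ≤ WClass.tau G x := by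
    rintro q ⟨d, ψ, L, hψ, rfl⟩
    exact hs.successProb_le hx hψ L
  -- Nonnegativity of `τ` spares a proof that the set is nonempty, since the supremum of the empty
  -- set is `0`.
  exact ⟨⟨_, hle⟩, Real.sSup_le hle (hs.tau_nonneg hx.1)⟩
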